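/- Let $(L,v)$ be an algebraically closed field with a non-trivial valuation $v:L\to vL\cup\{\infty\}$ (written additively, $vL$ being its value group), and let $K\subseteq L$ be a subfield such that $(K,v|_K)$ is also an algebraically closed non-trivially valued field and is an elementary substructure of $(L,v)$ in the language of rings together with a binary relation symbol interpreted as $v(x)\le v(y)$ (so $K\prec L$ are models of ACVF). Let $vK=v(K^\times)\subseteq vL$, and regard $vK\subseteq vL$ as structures in the language $\{+,-,0,\le\}$ of ordered abelian groups. Then the following are equivalent: 1. $W_1(K,L)$: for every subset $D\subseteq L$ definable in $L$ with parameters from $L$, the set $D\cap K$ is definable in $K$ with parameters from $K$; 2. for every ball $B$ of $L$, that is, every set of the form $\{x\in L: v(x-a)\ge\gamma\}$ or $\{x\in L: v(x-a)>\gamma\}$ with $a\in L$ and $\gamma\in vL$, the set $B\cap K$ is definable in $K$ with parameters from $K$; 3. $T_1(vK,vL)$: for every $\gamma\in vL$ the type $\mathrm{tp}(\gamma/vK)$ is definable, i.e. for every formula $\varphi(x,y)$ in the language of ordered abelian groups, with $x$ a single variable and $y$ a finite tuple of variables, the set $\{b\in (vK)^{|y|}: vL\models\varphi(\gamma,b)\}$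 is definable in $vK$ with parameters from $vK$. -/

import Mathlib

open FirstOrder FirstOrder.Language

namespace ACVF

universe u v w w'

section ModelTheory

variable (𝓛 : FirstOrder.Language.{u, v}) {M : Type w} {N : Type w'} [𝓛.Structure M] [𝓛.Structure N]

/-- `W_n(M, N)` for an extension `f : M → N`: for every subset `t` of `N ^ n` definable with
parameters from `N`, the trace of `t` on `M ^ n` is definable in `M` with parameters from `M`. -/
def W (n : ℕ) (f : M ↪[𝓛] N) : Prop :=
  ∀ t : Set (Fin n → N), (Set.univ : Set N).Definable 𝓛 t →
    (Set.univ : Set M).Definable 𝓛 {x : Fin n → M | f ∘ x ∈ t}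

/-- `tp(a / M)` for a tuple `a` of an extension `f : M → N`: the set of all formulas in the
variables `Fin n` with parameters from `M` that hold at `a` in `N`. A formula with parameters is
written as a formula whose free variables are either parameters (elements of `M`) or proper
variables. -/
def tp {n : ℕ} (f : M ↪[𝓛] N) (a : Fin n → N) : Set (𝓛.Formula (M ⊕ Fin n)) :=
  {ψ | ψ.Realize (Sum.elim f a)}

/-- A set `p` of formulas over `M` (in particular a type) is definable if for every formula
`φ(y, x)` the set of `b` in `M ^ |y|` with `φ(b, x) ∈ p` is definable in `M` with parameters
from `M`. -/
def IsDefinableType {n : ℕ} (p : Set (𝓛.Formula (M ⊕ Fin n))) : Prop :=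
  ∀ (m : ℕ) (φ : 𝓛.Formula (Fin m ⊕ Fin n)),
    (Set.univ : Set M).Definable 𝓛 {b : Fin m → M | φ.relabel (Sum.map b id) ∈ p}

/-- `T_n(M, N)`: every `n`-type over `M` realized in the extension `N` is definable. -/
def T (n : ℕ) (f : M ↪[𝓛] N) : Prop :=
  ∀ a : Fin n → N, IsDefinableType 𝓛 (tp 𝓛 f a)

end ModelTheory

section OrderedGroups

/-- The function symbols `+, -, 0` of ordered abelian groups. -/
inductive GroupFunc : ℕ → Type
  | add : GroupFunc 2
  | neg : GroupFunc 1
  | zero : GroupFunc 0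

/-- The language `{+, -, 0, ≤}` of ordered abelian groups. -/
def oag : FirstOrder.Language := ⟨GroupFunc, orderRel⟩

/-- An ordered abelian group as a structure in the language of ordered abelian groups. -/
instance oagStructure (G : Type*) [AddCommGroup G] [LinearOrder G] : oag.Structure G where
  funMap {n} f :=
    match n, f with
    | _, .add => fun x => x 0 + x 1
    | _, .neg => fun x => -x 0
    | _, .zero => fun _ => 0
  RelMap {n} r :=
    match n, r with
    | _, .le => fun x => x 0 ≤ x 1

/-- The inclusion of a subgroup, as an embedding of ordered abelian groups. -/
def oagInclusion {G : Type*} [AddCommGroup G] [LinearOrder G] (H : AddSubgroup G) :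
    H ↪[oag] G where
  toFun := Subtype.val
  inj' := Subtype.val_injective
  map_fun' {n} f x := by cases f <;> rfl
  map_rel' {n} r x := by cases r; rfl

end OrderedGroups

section ValuedFields

/-- The relation symbol `x ∣ y` of valued fields. -/
inductive DivRel : ℕ → Type
  | div : DivRel 2

/-- The language of valued fields: the language of rings together with a binary relation symbol
for the divisibility relation. -/
def ldiv : FirstOrder.Language := ⟨ringFunc, DivRel⟩

variable {F : Type*} {Γ : Type*} [Field F] [AddCommGroup Γ] [LinearOrder Γ] [IsOrderedAddMonoid Γ]

/-- A valued field `(F, v)` as a structure in the language of valued fields: the ring symbols are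
interpreted as usual, and `x ∣ y` if and only if `v x ≤ v y`. -/
@[reducible]
def valuedFieldStructure (v : AddValuation F (WithTop Γ)) : ldiv.Structure F where
  funMap {n} f :=
    match n, f with
    | _, .add => fun x => x 0 + x 1
    | _, .mul => fun x => x 0 * x 1
    | _, .neg => fun x => -x 0
    | _, .zero => fun _ => 0
    | _, .one => fun _ => 1
  RelMap {n} r :=
    match n, r with
    | _, .div => fun x => v (x 0) ≤ v (x 1)

/-- Models of ACVF: algebraically closed non-trivially valued fields. -/
structure IsModel (v : AddValuation F (WithTop Γ)) : Prop where
  isAlgClosed : IsAlgClosed F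
  nontrivial : ∃ x : F, x ≠ 0 ∧ v x ≠ 0

/-- The value group `vK` of a subfield `K` of a valued field. -/
def valueGroup (v : AddValuation F (WithTop Γ)) (K : Subfield F) : AddSubgroup Γ where
  carrier := {γ | ∃ x ∈ K, v x = (γ : WithTop Γ)}
  zero_mem' := ⟨1, K.one_mem, by simp⟩
  add_mem' := by
    rintro _ _ ⟨x, hx, h⟩ ⟨y, hy, h'⟩
    exact ⟨x * y, K.mul_mem hx hy, by rw [v.map_mul, h, h', WithTop.coe_add]⟩
  neg_mem' := by
    rintro γ ⟨x, hx, h⟩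
    have hx0 : x ≠ 0 := by
      rintro rfl
      simp at h
    refine ⟨x⁻¹, K.inv_mem hx, ?_⟩
    have e : v x + v x⁻¹ = 0 := by rw [← v.map_mul, mul_inv_cancel₀ hx0, v.map_one]
    rw [h] at e
    cases hy : v x⁻¹ with
    | top => simp [hy] at e
    | coe δ =>
      rw [hy] at e
      have e' : γ + δ = 0 := by exact_mod_cast e
      rw [neg_eq_of_add_eq_zero_right e']

/-- The balls of a valued field, closed or open, with center in the field and radius in the
value group. -/
def IsBall (v : AddValuation F (WithTop Γ)) (B : Set F) : Prop :=
  ∃ (a : F) (γ : Γ), B = {x | (γ : WithTop Γ) ≤ v (x - a)} ∨ B = {x | (γ : WithTop Γ) < v (x - a)}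

end ValuedFields

end ACVF

/-!
Both the traces of balls and the types over `vK` are governed by the cuts which the elements `γ` of
`vL` define in `vK`: conditions 2 and 3 each hold if and only if every such cut is trivial or has
an endpoint in `vK`. For balls this is so because a nonempty trace can be centered in `K`, and
because a subset of `K` definable in `K` is a Boolean combination of balls of `K`, whose finitely
many scales must contain the endpoint. For types it follows in the same way from quantifier
elimination for divisible ordered abelian groups, where half-spaces take the place of balls.
Condition 1 reduces to condition 2 since the subsets of `L` definable in `L` are Boolean
combinations of balls.

The last fact is quantifier elimination in ACVF together with the factorization of polynomials in
one variable: away from the roots, the value of a polynomial is that of a monomial in `x - r`,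
where `r` is the root nearest to `x`. Quantifiers are eliminated by extending partial maps between
ultrapowers: two points with the same quantifier-free type generate isomorphic valued fields, the
isomorphism extends to the algebraic closures since the extensions of a valuation to a normal
extension are conjugate, and one more element is matched by matching finitely many balls.
-/

namespace ACVF

section FiniteDetermination

variable {X Y κ κ' : Type*}

/-- Membership in `S` depends only on membership in finitely many members of the family `A`. This
is a form of the statement that `S` is a Boolean combination of finitely many members of `A`
that is easily contradicted: its failure produces a point inside and a point outside of `S` which
no member of `A` separates, in an ultrapower. -/
def FinitelyDetermined (A : κ → Set X) (S : Set X) : Prop :=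
  ∃ s : Finset κ, ∀ x y, (∀ k ∈ s, (x ∈ A k ↔ y ∈ A k)) → x ∈ S → y ∈ S

namespace FinitelyDetermined

theorem of_mem_family (A : κ → Set X) (k : κ) : FinitelyDetermined A (A k) :=
  ⟨{k}, fun _ _ h hx => (h k (Finset.mem_singleton_self k)).1 hx⟩

theorem empty (A : κ → Set X) : FinitelyDetermined A ∅ :=
  ⟨∅, fun _ _ _ hx => hx⟩

theorem compl {A : κ → Set X} {S : Set X} (h : FinitelyDetermined A S) :
    FinitelyDetermined A Sᶜ := by
  obtain ⟨s, hs⟩ := h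
  exact ⟨s, fun x y hxy hx hy => hx (hs y x (fun k hk => (hxy k hk).symm) hy)⟩

theorem inter {A : κ → Set X} {S T : Set X} (hS : FinitelyDetermined A S)
    (hT : FinitelyDetermined A T) : FinitelyDetermined A (S ∩ T) := by
  classical
  obtain ⟨s, hs⟩ := hS
  obtain ⟨t, ht⟩ := hT
  exact ⟨s ∪ t, fun x y hxy hx =>
    ⟨hs x y (fun k hk => hxy k (Finset.mem_union_left _ hk)) hx.1,
      ht x y (fun k hk => hxy k (Finset.mem_union_right _ hk)) hx.2⟩⟩

theorem preimage {A : κ → Set X} {S : Set X} (h : FinitelyDetermined A S) (g : Y → X) :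
    FinitelyDetermined (fun k => g ⁻¹' A k) (g ⁻¹' S) := by
  obtain ⟨s, hs⟩ := h
  exact ⟨s, fun x y => hs (g x) (g y)⟩

theorem trans {A : κ → Set X} {B : κ' → Set X} {S : Set X} (h : FinitelyDetermined A S)
    (hA : ∀ k, FinitelyDetermined B (A k)) : FinitelyDetermined B S := by
  classical
  obtain ⟨s, hs⟩ := h
  choose t ht using hA
  refine ⟨s.biUnion t, fun x y hxy hx => hs x y (fun k hk => ⟨ht k x y ?_, ht k y x ?_⟩) hx⟩
  · exact fun l hl => hxy l (Finset.mem_biUnion.2 ⟨k, hk, hl⟩)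
  · exact fun l hl => (hxy l (Finset.mem_biUnion.2 ⟨k, hk, hl⟩)).symm

end FinitelyDetermined

theorem exists_ultrafilter_of_not_finitelyDetermined {A : κ → Set X} {S : Set X}
    (h : ¬ FinitelyDetermined A S) :
    ∃ (W : Ultrafilter (Finset κ)) (x y : Finset κ → X), (∀ t, x t ∈ S) ∧ (∀ t, y t ∉ S) ∧
      ∀ k, ∀ᶠ t in (W : Filter (Finset κ)), (x t ∈ A k ↔ y t ∈ A k) := by
  simp only [FinitelyDetermined, not_exists, not_forall] at h
  choose x y hxy hx hy using h
  refine ⟨Ultrafilter.of Filter.atTop, x, y, hx, hy, fun k => ?_⟩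
  refine Filter.Eventually.filter_mono (Ultrafilter.of_le _) ?_
  filter_upwards [Filter.eventually_ge_atTop {k}] with t ht
  exact hxy t k (ht (Finset.mem_singleton_self k))

end FiniteDetermination

section QuantifierElimination

universe u v w

variable {𝓛 : FirstOrder.Language.{u, v}} {M : Type w} [𝓛.Structure M]

theorem FinitelyDetermined.definable {κ α : Type*} {C : Set M} {A : κ → Set (α → M)}
    {S : Set (α → M)} (h : FinitelyDetermined A S) (hA : ∀ k, C.Definable 𝓛 (A k)) :
    C.Definable 𝓛 S := by
  classical
  obtain ⟨s, hs⟩ := h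
  let atom (t : Finset κ) (k : κ) : Set (α → M) := if k ∈ t then A k else (A k)ᶜ
  let trace (x : α → M) : Finset κ := s.filter (x ∈ A ·)
  have definable_atom (t k) : C.Definable 𝓛 (atom t k) := by
    by_cases hk : k ∈ t <;> simp only [atom, hk, if_true, if_false]
    exacts [hA k, (hA k).compl]
  have mem_cell (x y) : y ∈ ⋂ k ∈ s, atom (trace x) k ↔ ∀ k ∈ s, (x ∈ A k ↔ y ∈ A k) := by
    simp only [Set.mem_iInter]
    refine forall₂_congr fun k hk => ?_
    by_cases hx : x ∈ A k <;> simp [atom, trace, hk, hx]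
  have eq_iUnion_cells : S = ⋃ t ∈ s.powerset.filter (∃ x ∈ S, trace x = ·), ⋂ k ∈ s, atom t k := by
    ext y
    simp only [Set.mem_iUnion, Finset.mem_filter, Finset.mem_powerset, exists_prop]
    constructor
    · exact fun hy => ⟨trace y, ⟨Finset.filter_subset _ _, y, hy, rfl⟩,
        (mem_cell y y).2 fun _ _ => Iff.rfl⟩
    · rintro ⟨t, ⟨-, x, hx, rfl⟩, hy⟩
      exact hs x y ((mem_cell x y).1 hy) hx
  rw [eq_iUnion_cells]
  exact Set.definable_biUnion_finset
    (fun t => Set.definable_biInter_finset (definable_atom t) s) _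

/-- A choice of basic sets in every power of `M` which satisfies the hypotheses of the usual test
for quantifier elimination: the atomic formulas are quantifier-free in the basic sets, and so is
the projection of every set which is quantifier-free in the basic sets. -/
structure EliminatesQuantifiers (𝓛 : FirstOrder.Language.{u, v}) {M : Type w} [𝓛.Structure M]
    {κ : Type → Type*} (A : ∀ ι, κ ι → Set (ι → M)) : Prop where
  reindex {ι ι' : Type} (g : ι → ι') (k : κ ι) :
    FinitelyDetermined (A ι') {z | z ∘ g ∈ A ι k}
  projection {ι : Type} {S : Set (Option ι → M)} (hS : FinitelyDetermined (A (Option ι)) S) :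
    FinitelyDetermined (A ι) {z | ∃ a, (fun o : Option ι => o.elim a z) ∈ S}
  equal {ι : Type} (t₁ t₂ : 𝓛.Term (M ⊕ ι)) :
    FinitelyDetermined (A ι) {z | t₁.realize (Sum.elim id z) = t₂.realize (Sum.elim id z)}
  rel {ι : Type} {n : ℕ} (R : 𝓛.Relations n) (ts : Fin n → 𝓛.Term (M ⊕ ι)) :
    FinitelyDetermined (A ι)
      {z | Structure.RelMap R fun i => (ts i).realize (Sum.elim id z)}

theorem exists_term_realize_eq {α : Type} {C : Set M} {n : ℕ} (t : 𝓛.Term ((C ⊕ α) ⊕ Fin n)) :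
    ∃ t' : 𝓛.Term (M ⊕ (α ⊕ Fin n)), ∀ z : α ⊕ Fin n → M, t'.realize (Sum.elim id z) =
      t.realize (Sum.elim (Sum.elim (fun c : C => (c : M)) (z ∘ Sum.inl)) (z ∘ Sum.inr)) := by
  refine ⟨t.relabel (Sum.elim (Sum.map (fun c : C => (c : M)) Sum.inl) (Sum.inr ∘ Sum.inr)),
    fun z => ?_⟩
  rw [Term.realize_relabel]
  congr 1
  ext ((c | a) | i) <;> rfl

namespace EliminatesQuantifiers

variable {κ : Type → Type*} {A : ∀ ι, κ ι → Set (ι → M)}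

theorem finitelyDetermined_reindex (hA : EliminatesQuantifiers 𝓛 A) {ι ι' : Type} (g : ι → ι')
    {S : Set (ι → M)} (hS : FinitelyDetermined (A ι) S) :
    FinitelyDetermined (A ι') {z | z ∘ g ∈ S} :=
  (hS.preimage (· ∘ g)).trans (hA.reindex g)

theorem finitelyDetermined_forall (hA : EliminatesQuantifiers 𝓛 A) {ι : Type}
    {S : Set (Option ι → M)} (hS : FinitelyDetermined (A (Option ι)) S) :
    FinitelyDetermined (A ι) {z | ∀ a, (fun o : Option ι => o.elim a z) ∈ S} := by
  convert (hA.projection hS.compl).compl using 1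
  ext z
  simp only [Set.mem_ofPred_eq, Set.mem_compl_iff, not_exists, not_not]

theorem finitelyDetermined_realize (hA : EliminatesQuantifiers 𝓛 A) {α : Type} {C : Set M}
    {n : ℕ} (φ : 𝓛.BoundedFormula (C ⊕ α) n) :
    FinitelyDetermined (A (α ⊕ Fin n)) {z |
      φ.Realize (Sum.elim (fun c : C => (c : M)) (z ∘ Sum.inl)) (z ∘ Sum.inr)} := by
  induction φ with
  | falsum => exact FinitelyDetermined.empty _
  | equal t₁ t₂ =>
    obtain ⟨t₁', h₁⟩ := exists_term_realize_eq t₁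
    obtain ⟨t₂', h₂⟩ := exists_term_realize_eq t₂
    have equal := hA.equal t₁' t₂'
    simp only [h₁, h₂] at equal
    exact equal
  | rel R ts =>
    choose ts' h using fun i => exists_term_realize_eq (ts i)
    have rel := hA.rel R ts'
    simp only [h] at rel
    exact rel
  | imp φ ψ h₁ h₂ =>
    convert (h₁.inter h₂.compl).compl using 1
    ext z
    simp [BoundedFormula.realize_imp]
  | @all n φ h =>
    let last : α ⊕ Fin (n + 1) → Option (α ⊕ Fin n) :=
      Sum.elim (some ∘ Sum.inl) (Fin.lastCases none (some ∘ Sum.inr))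
    convert hA.finitelyDetermined_forall (hA.finitelyDetermined_reindex last h) using 1
    ext z
    refine BoundedFormula.realize_all.trans (forall_congr' fun a => ?_)
    have snoc_eq : ((fun o : Option (α ⊕ Fin n) => o.elim a z) ∘ last) ∘ Sum.inr =
        (Fin.snoc (z ∘ Sum.inr) a : Fin (n + 1) → M) := by
      ext i
      refine Fin.lastCases ?_ (fun i => ?_) i <;> simp [last]
    simp only [Set.mem_ofPred_eq, snoc_eq]
    rfl

theorem finitelyDetermined_of_definable (hA : EliminatesQuantifiers 𝓛 A) {α : Type} {C : Set M}
    {S : Set (α → M)} (hS : C.Definable 𝓛 S) : FinitelyDetermined (A α) S := by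
  obtain ⟨φ, rfl⟩ := Set.definable_iff_exists_formula_sum.1 hS
  convert hA.finitelyDetermined_reindex (Sum.elim id Fin.elim0 : α ⊕ Fin 0 → α)
    (hA.finitelyDetermined_realize φ) using 1
  ext z
  refine iff_of_eq ?_
  simp only [Set.mem_ofPred_eq, Formula.Realize]
  congr 1
  exact Subsingleton.elim _ _

end EliminatesQuantifiers

end QuantifierElimination

section Order

theorem cmp_eq_cmp_iff {α β : Type*} [LinearOrder α] [LinearOrder β] {a b : α} {c d : β} :
    cmp a b = cmp c d ↔ (a ≤ b ↔ c ≤ d) ∧ (a < b ↔ c < d) := by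
  refine ⟨fun h => ⟨le_iff_le_of_cmp_eq_cmp h, lt_iff_lt_of_cmp_eq_cmp h⟩, fun ⟨hle, hlt⟩ => ?_⟩
  rcases lt_trichotomy a b with h | h | h
  · rw [h.cmp_eq_lt, (hlt.1 h).cmp_eq_lt]
  · rw [h.cmp_eq_eq, (le_antisymm (hle.1 h.le) (not_lt.1 (mt hlt.2 h.not_lt))).cmp_eq_eq]
  · rw [h.cmp_eq_gt, (not_le.1 (mt hle.2 h.not_ge)).cmp_eq_gt]

theorem exists_cmp_eq_of_finset {α β κ : Type*} [LinearOrder α] [LinearOrder β]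
    [DenselyOrdered β] [NoMinOrder β] [NoMaxOrder β] [Nonempty β] {s : Finset κ} {f : κ → α}
    {g : κ → β} (hfg : ∀ k ∈ s, ∀ l ∈ s, cmp (f k) (f l) = cmp (g k) (g l)) (a : α) :
    ∃ b : β, ∀ k ∈ s, cmp a (f k) = cmp b (g k) := by
  classical
  by_cases hex : ∃ k ∈ s, f k = a
  · obtain ⟨k, hk, rfl⟩ := hex
    exact ⟨g k, hfg k hk⟩
  push Not at hex
  obtain ⟨b, hlo, hhi⟩ := Order.exists_between_finsets ((s.filter (f · < a)).image g)
    ((s.filter (a < f ·)).image g) (by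
      simp only [Finset.forall_mem_image, Finset.mem_filter]
      exact fun k hk l hl =>
        (lt_iff_lt_of_cmp_eq_cmp (hfg k hk.1 l hl.1)).1 (hk.2.trans hl.2))
  simp only [Finset.forall_mem_image, Finset.mem_filter] at hlo hhi
  refine ⟨b, fun k hk => ?_⟩
  rcases lt_or_gt_of_ne (hex k hk) with h | h
  · rw [h.cmp_eq_gt, (hlo ⟨hk, h⟩).cmp_eq_gt]
  · rw [h.cmp_eq_lt, (hhi ⟨hk, h⟩).cmp_eq_lt]

@[to_additive denselyOrdered_of_exists_two_nsmul_eq]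
theorem denselyOrdered_of_exists_sq_eq {G : Type*} [CommGroup G] [LinearOrder G]
    [IsOrderedMonoid G] (h : ∀ a : G, ∃ b, b ^ 2 = a) : DenselyOrdered G := by
  refine ⟨fun a b hab => ?_⟩
  obtain ⟨c, hc⟩ := h (a * b)
  rw [pow_two] at hc
  refine ⟨c, ?_, ?_⟩ <;> by_contra! hle
  · exact (mul_le_mul' hle hle).not_gt (hc ▸ mul_lt_mul_right hab a)
  · exact (mul_le_mul' hle hle).not_gt (hc ▸ mul_lt_mul_left hab b)

end Order

section AlgebraicallyClosedValuedField

variable {E Γ₀ : Type*} [Field E] [LinearOrderedCommGroupWithZero Γ₀] (w : Valuation E Γ₀)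

theorem map_sub_eq_max {x r a : E} (h : w (x - r) ≤ w (x - a)) :
    w (x - a) = max (w (x - r)) (w (a - r)) := by
  rw [← sub_sub_sub_cancel_right x a r] at h ⊢
  rcases lt_trichotomy (w (x - r)) (w (a - r)) with hlt | heq | hgt
  · rw [w.map_sub_eq_of_lt_right hlt, max_eq_right hlt.le]
  · exact le_antisymm (w.map_sub _ _) (by rwa [← heq, max_self])
  · rw [w.map_sub_eq_of_lt_left hgt, max_eq_left hgt.le]

theorem map_sub_lt_map_sub_iff {x r a : E} : w (x - a) < w (x - r) ↔ w (x - a) < w (r - a) := by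
  constructor
  · intro h
    exact (lt_max_iff.1 (h.trans_eq (map_sub_eq_max w h.le))).resolve_left (lt_irrefl _)
  · intro h
    by_contra! hle
    rw [map_sub_eq_max w hle, w.map_sub_swap a r] at h
    exact (le_max_right _ _).not_gt h

theorem map_sub_le_map_sub_of_cmp_eq {x y r a : E}
    (h : cmp (w (x - a)) (w (r - a)) = cmp (w (y - a)) (w (r - a)))
    (hx : w (x - r) ≤ w (x - a)) : w (y - r) ≤ w (y - a) := by
  rwa [← not_lt, map_sub_lt_map_sub_iff, ← lt_iff_lt_of_cmp_eq_cmp h, ← map_sub_lt_map_sub_iff,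
    not_lt]

theorem cmp_mul_pow_eq {a b t : Γ₀} (ht : t ≠ 0) (m d : ℕ) :
    cmp (a * t ^ m) (b * t ^ (m + d)) = cmp a (b * t ^ d) := by
  have hpos : 0 < t ^ m := zero_lt_iff.2 (pow_ne_zero m ht)
  rw [pow_add, mul_left_comm, mul_comm a]
  exact (strictMono_mul_left_of_pos hpos).cmp_map_eq _ _

variable [IsAlgClosed E]

-- The critical value of `t` is the one at which the two monomials are equal.
theorem exists_cmp_monomial_eq (e e' : E) (m m' : ℕ) : ∃ c : E, ∀ t t' : Γ₀, t ≠ 0 → t' ≠ 0 →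
    cmp t (w c) = cmp t' (w c) →
      cmp (w e * t ^ m) (w e' * t ^ m') = cmp (w e * t' ^ m) (w e' * t' ^ m') := by
  wlog hm : m ≤ m' generalizing e e' m m'
  · obtain ⟨c, hc⟩ := this e' e m' m (not_le.1 hm).le
    exact ⟨c, fun t t' ht ht' h => cmp_eq_cmp_symm.1 (hc t t' ht ht' h)⟩
  obtain ⟨d, rfl⟩ := Nat.exists_eq_add_of_le hm
  suffices h : ∃ c : E, ∀ t t' : Γ₀, t ≠ 0 → t' ≠ 0 → cmp t (w c) = cmp t' (w c) →
      cmp (w e) (w e' * t ^ d) = cmp (w e) (w e' * t' ^ d) by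
    obtain ⟨c, hc⟩ := h
    refine ⟨c, fun t t' ht ht' h => ?_⟩
    rw [cmp_mul_pow_eq ht, cmp_mul_pow_eq ht', hc t t' ht ht' h]
  rcases eq_or_ne e' 0 with rfl | he'
  · exact ⟨0, fun t t' _ _ _ => by simp only [map_zero, zero_mul]⟩
  rcases eq_or_ne d 0 with rfl | hd
  · exact ⟨0, fun t t' _ _ _ => by simp only [pow_zero]⟩
  obtain ⟨c, hc⟩ := IsAlgClosed.exists_pow_nat_eq (e / e') (Nat.pos_of_ne_zero hd)
  have hpos : 0 < w e' := zero_lt_iff.2 ((map_ne_zero w).2 he')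
  have cmp_eq (t : Γ₀) : cmp (w e) (w e' * t ^ d) = cmp (w c) t := by
    rw [← mul_div_cancel₀ e he', ← hc, map_mul, map_pow,
      (strictMono_mul_left_of_pos hpos).cmp_map_eq,
      (pow_left_strictMonoOn₀ hd).cmp_map_eq zero_le zero_le]
  exact ⟨c, fun t t' _ _ h => by rw [cmp_eq, cmp_eq, cmp_eq_cmp_symm, h]⟩

theorem exists_map_sub_eq_one {s : Finset E} (h0 : (0 : E) ∈ s) (hs : ∀ b ∈ s, w b ≤ 1) :
    ∃ u : E, ∀ b ∈ s, w (u - b) = 1 := by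
  let q : Polynomial E := ∏ b ∈ s, (Polynomial.X - Polynomial.C b)
  have natDegree_ne : q.natDegree ≠ 0 := by
    rw [Polynomial.natDegree_finsetProd_X_sub_C_eq_card]
    exact Finset.card_ne_zero_of_mem h0
  obtain ⟨u, hu : q.eval u = 1⟩ := IsAlgClosed.eval_surjective natDegree_ne 1
  have prod_eq_one : ∏ b ∈ s, w (u - b) = 1 := by
    rw [← map_prod, ← w.map_one, ← hu, Polynomial.eval_prod]
    simp only [Polynomial.eval_sub, Polynomial.eval_X, Polynomial.eval_C]
  have map_u_le : w u ≤ 1 := by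
    by_contra! hlt
    have map_sub_eq (b) (hb : b ∈ s) : w (u - b) = w u :=
      w.map_sub_eq_of_lt_left ((hs b hb).trans_lt hlt)
    rw [Finset.prod_eq_pow_card map_sub_eq] at prod_eq_one
    exact (one_lt_pow' hlt (Finset.card_ne_zero_of_mem h0)).ne' prod_eq_one
  exact ⟨u, (Finset.prod_eq_one_iff_of_le_one' fun b hb =>
    (w.map_sub u b).trans (max_le map_u_le (hs b hb))).1 prod_eq_one⟩

theorem exists_forall_map_sub_eq_max {s : Finset E} {r d : E} (hr : r ∈ s) (hd : d ≠ 0) :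
    ∃ y : E, ∀ a ∈ s, w (y - a) = max (w d) (w (a - r)) := by
  classical
  have hpos : 0 < w d := zero_lt_iff.2 ((map_ne_zero w).2 hd)
  have map_div_le_iff (a : E) : w ((a - r) / d) ≤ 1 ↔ w (a - r) ≤ w d := by
    rw [map_div₀, div_le_one₀ hpos]
  let near : Finset E := (s.filter fun a => w (a - r) ≤ w d).image fun a => (a - r) / d
  obtain ⟨u, hu⟩ := exists_map_sub_eq_one w (s := near)
    (Finset.mem_image.2 ⟨r, by simp [hr], by simp⟩) (by
      simp only [near, Finset.forall_mem_image, Finset.mem_filter, map_div_le_iff]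
      exact fun a ha => ha.2)
  have map_near (a) (ha : a ∈ s) (hle : w (a - r) ≤ w d) : w (r + d * u - a) = w d := by
    have map_sub_eq := hu ((a - r) / d)
      (Finset.mem_image_of_mem (fun a => (a - r) / d) (Finset.mem_filter.2 ⟨ha, hle⟩))
    rw [show r + d * u - a = d * (u - (a - r) / d) by field_simp; ring, map_mul, map_sub_eq,
      mul_one]
  refine ⟨r + d * u, fun a ha => ?_⟩
  rcases le_or_gt (w (a - r)) (w d) with hle | hlt
  · rw [map_near a ha hle, max_eq_left hle]
  · have map_sub_r : w (r + d * u - r) = w d :=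
      map_near r hr (by simp)
    rw [← sub_sub_sub_cancel_right _ a r, w.map_sub_eq_of_lt_right (map_sub_r.trans_lt hlt),
      max_eq_right hlt.le]

theorem exists_cmp_map_eq (hw : ∃ e, e ≠ 0 ∧ w e ≠ 1) (s : Finset E) {t : Γ₀} (ht : t ≠ 0) :
    ∃ d : E, d ≠ 0 ∧ ∀ c ∈ s, cmp t (w c) = cmp (w d) (w c) := by
  classical
  let H : Subgroup Γ₀ˣ := (Units.map (w : E →* Γ₀)).range
  have : Nontrivial H := by
    obtain ⟨e, he, hwe⟩ := hw
    exact ⟨⟨_, Units.mk0 e he, rfl⟩, 1, fun h => hwe (congrArg (fun u : H => (u : Γ₀ˣ).1) h)⟩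
  have : DenselyOrdered H := denselyOrdered_of_exists_sq_eq <| by
    rintro ⟨_, e, rfl⟩
    obtain ⟨c, hc⟩ := IsAlgClosed.exists_pow_nat_eq (e : E) two_pos
    have hc0 : c ≠ 0 := by rintro rfl; exact e.ne_zero (by simpa using hc.symm)
    exact ⟨⟨_, Units.mk0 c hc0, rfl⟩, by ext; simp [← hc]⟩
  obtain ⟨⟨_, d, rfl⟩, hd⟩ := exists_cmp_eq_of_finset (s := s.subtype (· ≠ 0))
    (f := fun c => w c) (g := fun c => (⟨_, Units.mk0 c.1 c.2, rfl⟩ : H))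
    (fun k _ l _ => rfl) t
  refine ⟨d, d.ne_zero, fun c hc => ?_⟩
  rcases eq_or_ne c 0 with rfl | hc0
  · rw [map_zero, (zero_lt_iff.2 ht).cmp_eq_gt,
      (zero_lt_iff.2 ((map_ne_zero w).2 d.ne_zero)).cmp_eq_gt]
  · exact hd ⟨c, hc0⟩ (Finset.mem_subtype.2 hc)

end AlgebraicallyClosedValuedField

section Balls

variable {E M Γ₀ : Type*} [Field E] [Field M] [LinearOrderedCommGroupWithZero Γ₀]
  (v : Valuation M Γ₀) (i : E →+* M)

/-- The family of all closed balls (left summand) and open balls (right summand) of `M`, indexed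
by the pairs of a center `a` and a scale `c` in `E`: the radius is the value of `c`, so it may
be `0`. -/
def ballFamily : (E × E) ⊕ (E × E) → Set M
  | .inl p => {x | v (x - i p.1) ≤ v (i p.2)}
  | .inr p => {x | v (x - i p.1) < v (i p.2)}

theorem finitelyDetermined_ballFamily_of_finset {C : Finset (E × E)} {S : Set M}
    (h : ∀ x y, (∀ p ∈ C, cmp (v (x - i p.1)) (v (i p.2)) = cmp (v (y - i p.1)) (v (i p.2))) →
      x ∈ S → y ∈ S) : FinitelyDetermined (ballFamily v i) S :=
  ⟨C.disjSum C, fun x y hxy => h x y fun p hp => cmp_eq_cmp_iff.2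
    ⟨hxy (.inl p) (Finset.inl_mem_disjSum.2 hp), hxy (.inr p) (Finset.inr_mem_disjSum.2 hp)⟩⟩

variable [IsAlgClosed E]

theorem map_eval₂_eq_prod_roots (f : Polynomial E) (x : M) :
    v (f.eval₂ i x) = v (i f.leadingCoeff) * (f.roots.map fun ρ => v (x - i ρ)).prod := by
  conv_lhs => rw [(IsAlgClosed.splits f).eq_prod_roots, Polynomial.eval₂_mul, Polynomial.eval₂_C,
    map_mul, ← Polynomial.coe_eval₂RingHom, map_multiset_prod, map_multiset_prod]
  simp only [Multiset.map_map, Function.comp_apply, Polynomial.coe_eval₂RingHom,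
    Polynomial.eval₂_sub, Polynomial.eval₂_X, Polynomial.eval₂_C]

section NearestRoot

variable [DecidableEq E]

/-- The coefficient of the monomial in `x - r` which has the same value as `f x` for all `x` for
which the roots of `f` in `T` are those that are as far from `r` as `x`, or farther. -/
noncomputable def nearestRootCoeff (f : Polynomial E) (r : E) (T : Finset E) : E :=
  f.leadingCoeff * ((f.roots.filter (· ∈ T)).map fun ρ => ρ - r).prod

/-- The degree of the monomial of `nearestRootCoeff`. -/
noncomputable def nearestRootDegree (f : Polynomial E) (T : Finset E) : ℕ :=
  (f.roots.filter (· ∉ T)).card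

theorem map_eval₂_eq_monomial {f : Polynomial E} {R T : Finset E} {x : M} {r : E}
    (hf : ∀ ρ ∈ f.roots, ρ ∈ R) (hr : ∀ ρ ∈ R, v (x - i r) ≤ v (x - i ρ))
    (hT : ∀ ρ ∈ R, (ρ ∈ T ↔ v (x - i r) ≤ v (i (ρ - r)))) :
    v (f.eval₂ i x) =
      v (i (nearestRootCoeff f r T)) * v (x - i r) ^ nearestRootDegree f T := by
  have map_far : ∀ ρ ∈ f.roots.filter (· ∈ T), v (x - i ρ) = v (i (ρ - r)) := fun ρ hρ => by
    obtain ⟨hρ, hρT⟩ := Multiset.mem_filter.1 hρ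
    rw [map_sub_eq_max v (hr ρ (hf ρ hρ)), ← map_sub, max_eq_right ((hT ρ (hf ρ hρ)).1 hρT)]
  have map_close : ∀ ρ ∈ f.roots.filter (· ∉ T), v (x - i ρ) = v (x - i r) := fun ρ hρ => by
    obtain ⟨hρ, hρT⟩ := Multiset.mem_filter.1 hρ
    rw [map_sub_eq_max v (hr ρ (hf ρ hρ)), ← map_sub,
      max_eq_left (not_le.1 (mt (hT ρ (hf ρ hρ)).2 hρT)).le]
  rw [map_eval₂_eq_prod_roots, ← Multiset.filter_add_not (· ∈ T) f.roots, Multiset.map_add,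
    Multiset.prod_add, Multiset.map_congr rfl map_far, Multiset.map_congr rfl map_close,
    Multiset.map_const', Multiset.prod_replicate, nearestRootCoeff, map_mul, map_mul, mul_assoc,
    map_multiset_prod, map_multiset_prod, Multiset.map_map, Multiset.map_map]
  rfl

end NearestRoot

theorem finitelyDetermined_polynomial (f g : Polynomial E) : FinitelyDetermined (ballFamily v i)
    {x | v (f.eval₂ i x) ≤ v (g.eval₂ i x)} := by
  classical
  let R : Finset E := insert 0 (f.roots.toFinset ∪ g.roots.toFinset)
  have roots_f : ∀ ρ ∈ f.roots, ρ ∈ R := fun ρ hρ => by simp [R, Multiset.mem_toFinset.2 hρ]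
  have roots_g : ∀ ρ ∈ g.roots, ρ ∈ R := fun ρ hρ => by simp [R, Multiset.mem_toFinset.2 hρ]
  choose crit hcrit using fun (r : E) (T : Finset E) =>
    exists_cmp_monomial_eq (v.comap i) (nearestRootCoeff f r T) (nearestRootCoeff g r T)
      (nearestRootDegree f T) (nearestRootDegree g T)
  let C : Finset (E × E) := ((R ×ˢ R).image fun p => (p.1, p.2 - p.1)) ∪
    ((R ×ˢ R.powerset).image fun p => (p.1, crit p.1 p.2))
  refine finitelyDetermined_ballFamily_of_finset v i (C := C) fun x y hxy hx => ?_
  have cmp_sub {ρ σ} (hρ : ρ ∈ R) (hσ : σ ∈ R) :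
      cmp (v (x - i ρ)) (v (i (σ - ρ))) = cmp (v (y - i ρ)) (v (i (σ - ρ))) :=
    hxy (ρ, σ - ρ) (Finset.mem_union_left _ (Finset.mem_image_of_mem
      (fun p : E × E => (p.1, p.2 - p.1)) (Finset.mk_mem_product hρ hσ)))
  obtain ⟨r, hr, nearest_x⟩ := R.exists_min_image (fun ρ => v (x - i ρ)) ⟨0, by simp [R]⟩
  have nearest_y (ρ) (hρ : ρ ∈ R) : v (y - i r) ≤ v (y - i ρ) :=
    map_sub_le_map_sub_of_cmp_eq v (map_sub i r ρ ▸ cmp_sub hρ hr) (nearest_x ρ hρ)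
  have eq_center_iff : v (x - i r) = 0 ↔ v (y - i r) = 0 := by
    simpa using eq_iff_eq_of_cmp_eq_cmp (cmp_sub hr hr)
  by_cases hx0 : v (x - i r) = 0
  · rwa [sub_eq_zero.1 (v.zero_iff.1 (eq_center_iff.1 hx0)),
      ← sub_eq_zero.1 (v.zero_iff.1 hx0)]
  let T : Finset E := R.filter fun ρ => v (x - i r) ≤ v (i (ρ - r))
  have mem_T_x (ρ) (hρ : ρ ∈ R) : ρ ∈ T ↔ v (x - i r) ≤ v (i (ρ - r)) := by simp [T, hρ]
  have mem_T_y (ρ) (hρ : ρ ∈ R) : ρ ∈ T ↔ v (y - i r) ≤ v (i (ρ - r)) :=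
    (mem_T_x ρ hρ).trans (le_iff_le_of_cmp_eq_cmp (cmp_sub hr hρ))
  have cmp_monomial := hcrit r T _ _ hx0 (mt eq_center_iff.2 hx0) (hxy (r, crit r T)
    (Finset.mem_union_right _ (Finset.mem_image_of_mem (fun p : E × Finset E => (p.1, crit p.1 p.2))
      (Finset.mk_mem_product hr (Finset.mem_powerset.2 (Finset.filter_subset _ _))))))
  simp only [Set.mem_ofPred_eq, map_eval₂_eq_monomial v i roots_f nearest_x mem_T_x,
    map_eval₂_eq_monomial v i roots_g nearest_x mem_T_x,
    map_eval₂_eq_monomial v i roots_f nearest_y mem_T_y,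
    map_eval₂_eq_monomial v i roots_g nearest_y mem_T_y] at hx ⊢
  exact (le_iff_le_of_cmp_eq_cmp cmp_monomial).1 hx

theorem exists_mem_ballFamily_iff (hv : ∃ e, e ≠ 0 ∧ v (i e) ≠ 1)
    (s : Finset ((E × E) ⊕ (E × E))) (x : M) :
    ∃ y : E, ∀ k ∈ s, (x ∈ ballFamily v i k ↔ i y ∈ ballFamily v i k) := by
  classical
  let C : Finset (E × E) := s.image (Sum.elim id id)
  suffices h : ∃ y : E, ∀ p ∈ C,
      cmp (v (x - i p.1)) (v (i p.2)) = cmp (v (i y - i p.1)) (v (i p.2)) by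
    obtain ⟨y, hy⟩ := h
    refine ⟨y, ?_⟩
    rintro (p | p) hp
    · exact le_iff_le_of_cmp_eq_cmp (hy p (Finset.mem_image.2 ⟨_, hp, rfl⟩))
    · exact lt_iff_lt_of_cmp_eq_cmp (hy p (Finset.mem_image.2 ⟨_, hp, rfl⟩))
  let A : Finset E := insert 0 (C.image Prod.fst)
  have fst_mem {p} (hp : p ∈ C) : p.1 ∈ A :=
    Finset.mem_insert_of_mem (Finset.mem_image_of_mem _ hp)
  obtain ⟨r, hr, nearest⟩ := A.exists_min_image (fun a => v (x - i a)) (Finset.insert_nonempty _ _)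
  rcases eq_or_ne (v (x - i r)) 0 with h0 | ht
  · rw [v.zero_iff, sub_eq_zero] at h0
    exact ⟨r, fun p _ => by rw [h0]⟩
  obtain ⟨d, hd, cmp_d⟩ := exists_cmp_map_eq (v.comap i) hv (C.image Prod.snd) ht
  obtain ⟨y, hy⟩ := exists_forall_map_sub_eq_max (v.comap i) hr hd
  simp only [Valuation.comap_apply] at cmp_d hy
  refine ⟨y, fun p hp => cmp_eq_cmp_iff.2 ?_⟩
  obtain ⟨le_iff, lt_iff⟩ := cmp_eq_cmp_iff.1 (cmp_d p.2 (Finset.mem_image_of_mem _ hp))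
  rw [map_sub_eq_max v (nearest _ (fst_mem hp)), ← map_sub i y, hy _ (fst_mem hp), ← map_sub,
    max_le_iff, max_le_iff, max_lt_iff, max_lt_iff, le_iff, lt_iff]
  exact ⟨Iff.rfl, Iff.rfl⟩

theorem exists_le_map_eval_iff (hv : ∃ e, e ≠ 0 ∧ v (i e) ≠ 1)
    (s : Finset (Polynomial E × Polynomial E)) (x : M) :
    ∃ y : E, ∀ p ∈ s, (v (p.1.eval₂ i x) ≤ v (p.2.eval₂ i x) ↔
      v (i (p.1.eval y)) ≤ v (i (p.2.eval y))) := by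
  classical
  choose t ht using fun p : Polynomial E × Polynomial E =>
    finitelyDetermined_polynomial v i p.1 p.2
  obtain ⟨y, hy⟩ := exists_mem_ballFamily_iff v i hv (s.biUnion t) x
  refine ⟨y, fun p hp => ?_⟩
  rw [← Polynomial.eval₂_at_apply, ← Polynomial.eval₂_at_apply]
  exact ⟨ht p x (i y) fun k hk => hy k (Finset.mem_biUnion.2 ⟨p, hp, hk⟩),
    ht p (i y) x fun k hk => (hy k (Finset.mem_biUnion.2 ⟨p, hp, hk⟩)).symm⟩

end Balls

section Conjugacy

theorem exists_fraction_of_aeval_eq_zero {B A : Type*} [CommRing B] [CommRing A] [Algebra B A]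
    [FaithfulSMul B A] (hB : integralClosure B A = ⊥) (P : Ideal B) {x : A} {f : Polynomial B}
    (hf : f.aeval x = 0) {k : ℕ} (hk : f.coeff k ∉ P) :
    ∃ p s : B, s ∉ P ∧ (x * algebraMap B A s = algebraMap B A p ∨
      x * algebraMap B A p = algebraMap B A s) := by
  induction hd : f.natDegree using Nat.strong_induction_on generalizing f with | h d ih
  obtain ⟨b, hb⟩ := Algebra.mem_bot.1 (hB.le (isIntegral_leadingCoeff_smul f x hf))
  have hab : x * algebraMap B A f.leadingCoeff = algebraMap B A b := by
    rw [hb, Algebra.smul_def, mul_comm]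
  by_cases haP : f.leadingCoeff ∈ P
  swap
  · exact ⟨b, f.leadingCoeff, haP, Or.inl hab⟩
  by_cases hbP : b ∈ P
  swap
  · exact ⟨f.leadingCoeff, b, hbP, Or.inr hab⟩
  obtain _ | d := d
  · rw [Polynomial.eq_C_of_natDegree_eq_zero hd, Polynomial.aeval_C,
      FaithfulSMul.algebraMap_eq_zero_iff] at hf
    rw [Polynomial.eq_C_of_natDegree_eq_zero hd, hf] at hk
    simp at hk
  -- `a x ^ (d + 1) = b x ^ d` for the leading coefficient `a`: this lowers the degree.
  refine ih _ ?_ (f := f.eraseLead + Polynomial.C b * Polynomial.X ^ d) ?_ ?_ rfl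
  · have := f.eraseLead_natDegree_le
    exact Order.lt_add_one_iff.2 (Polynomial.natDegree_add_le_of_degree_le (by omega)
      (Polynomial.natDegree_C_mul_X_pow_le _ _))
  · have := congrArg (Polynomial.aeval x) f.eraseLead_add_C_mul_X_pow
    rw [← this, hd] at hf
    simp only [map_add, map_mul, Polynomial.aeval_C, map_pow, Polynomial.aeval_X] at hf ⊢
    rw [← hab, ← hf]
    ring
  · have hkd : k ≠ f.natDegree := by
      rintro rfl
      exact hk haP
    rw [Polynomial.coeff_add, Polynomial.eraseLead_coeff_of_ne _ hkd, Polynomial.coeff_C_mul]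
    exact fun h => hk ((Ideal.add_mem_iff_left P (P.mul_mem_right _ hbP)).1 h)

variable {F E : Type*} [Field F] [Field E]

theorem valuation_lt_one_iff_inv_notMem {W : ValuationSubring E} {x : E} :
    W.valuation x < 1 ↔ x = 0 ∨ x⁻¹ ∉ W := by
  rw [← ValuationSubring.mem_nonunits_iff, ValuationSubring.mem_nonunits_iff_or]

theorem valuation_comap_lt_one_iff {W : ValuationSubring E} {g : F →+* E} {x : F} :
    (W.comap g).valuation x < 1 ↔ W.valuation (g x) < 1 := by
  rw [valuation_lt_one_iff_inv_notMem, valuation_lt_one_iff_inv_notMem,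
    ValuationSubring.mem_comap, map_inv₀, map_eq_zero]

variable [Algebra F E]

theorem exists_primitive_aeval_eq_zero (V : ValuationSubring F) {x : E} (hx : IsAlgebraic F x) :
    ∃ f : Polynomial V, f.aeval x = 0 ∧ ∃ k, f.coeff k = 1 := by
  obtain ⟨g, hg0, hg⟩ := hx
  obtain ⟨k, hk, hmax⟩ := g.support.exists_max_image (fun l => V.valuation (g.coeff l))
    (Polynomial.support_nonempty.2 hg0)
  have hk0 : g.coeff k ≠ 0 := Polynomial.mem_support_iff.1 hk
  have coeff_mem : Polynomial.C (g.coeff k)⁻¹ * g ∈ Polynomial.lifts (algebraMap V F) := by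
    refine (Polynomial.lifts_iff_coeff_lifts _).2 fun l => ?_
    suffices (Polynomial.C (g.coeff k)⁻¹ * g).coeff l ∈ V from ⟨⟨_, this⟩, rfl⟩
    rw [Polynomial.coeff_C_mul, ← V.valuation_le_one_iff, map_mul, map_inv₀,
      inv_mul_le_one₀ (zero_lt_iff.2 ((map_ne_zero _).2 hk0))]
    by_cases hl : g.coeff l = 0
    · simp [hl]
    · exact hmax l (Polynomial.mem_support_iff.2 hl)
  obtain ⟨f, hf⟩ := coeff_mem
  rw [Polynomial.coe_mapRingHom] at hf
  refine ⟨f, ?_, k, Subtype.val_injective ?_⟩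
  · rw [← Polynomial.aeval_map_algebraMap F, hf, map_mul, hg, mul_zero]
  · have := congrArg (Polynomial.coeff · k) hf
    rwa [Polynomial.coeff_map, Polynomial.coeff_C_mul, inv_mul_cancel₀ hk0] at this

variable {V : ValuationSubring F} {W W₁ W₂ : ValuationSubring E}

theorem mem_of_isIntegral (h : V ≤ W.comap (algebraMap F E)) {x : E} (hx : IsIntegral V x) :
    x ∈ W := by
  let φ : V →+* W := ((algebraMap F E).comp V.subtype).codRestrict W.toSubring fun a => h a.2
  obtain ⟨p, hp, hpx⟩ := hx
  have : IsIntegral W x := ⟨p.map φ, hp.map φ, by rw [Polynomial.eval₂_map]; exact hpx⟩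
  obtain ⟨y, rfl⟩ := IsIntegrallyClosed.isIntegral_iff.1 this
  exact y.2

/-- The center on the integral closure of `V` of a valuation ring `W` containing `V`: the prime
ideal of the integral elements which are not units of `W`. -/
def center (h : V ≤ W.comap (algebraMap F E)) : Ideal (integralClosure V E) :=
  (IsLocalRing.maximalIdeal W).comap ((integralClosure V E).val.toRingHom.codRestrict
    W.toSubring fun b => mem_of_isIntegral h b.2)

instance isPrime_center (h : V ≤ W.comap (algebraMap F E)) : (center h).IsPrime :=
  Ideal.IsPrime.comap _

theorem mem_center_iff {h : V ≤ W.comap (algebraMap F E)} {b : integralClosure V E} :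
    b ∈ center h ↔ W.valuation b < 1 :=
  ValuationSubring.valuation_lt_one_iff W _

theorem notMem_center_iff {h : V ≤ W.comap (algebraMap F E)} {b : integralClosure V E} :
    b ∉ center h ↔ W.valuation b = 1 := by
  rw [mem_center_iff, not_lt]
  exact ⟨((W.valuation_le_one_iff _).2 (mem_of_isIntegral h b.2)).antisymm, Eq.ge⟩

theorem exists_mul_eq_notMem_center [Algebra.IsAlgebraic F E] (h : V ≤ W.comap (algebraMap F E))
    {x : E} (hx : x ∈ W) : ∃ p s : integralClosure V E, s ∉ center h ∧ x * s = p := by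
  obtain ⟨f, hf, k, hk⟩ := exists_primitive_aeval_eq_zero V
    (Algebra.IsAlgebraic.isAlgebraic (R := F) x)
  obtain ⟨p, s, hs, hps | hps⟩ := exists_fraction_of_aeval_eq_zero
    (integralClosure_idem (R := V) (A := E)) (center h)
    (f := f.map (algebraMap V (integralClosure V E))) (k := k)
    ((Polynomial.aeval_map_algebraMap _ _ _).trans hf)
    (by rw [Polynomial.coeff_map, hk, map_one]; exact (center h).one_notMem)
  · exact ⟨p, s, hs, hps⟩
  · refine ⟨s, p, fun hp => hs ?_, hps⟩
    rw [mem_center_iff] at hp ⊢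
    change x * (p : E) = s at hps
    rw [← hps, map_mul]
    exact mul_lt_one_of_nonneg_of_lt_one_right ((W.valuation_le_one_iff _).2 hx) zero_le hp

theorem le_of_center_eq [Algebra.IsAlgebraic F E] {h₁ : V ≤ W₁.comap (algebraMap F E)}
    {h₂ : V ≤ W₂.comap (algebraMap F E)} (h : center h₁ = center h₂) : W₁ ≤ W₂ := by
  intro x hx
  obtain ⟨p, s, hs, hps⟩ := exists_mul_eq_notMem_center h₁ hx
  rw [h, notMem_center_iff] at hs
  have : W₂.valuation x = W₂.valuation p := by rw [← hps, map_mul, hs, mul_one]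
  rw [← W₂.valuation_le_one_iff, this]
  exact (W₂.valuation_le_one_iff _).2 (mem_of_isIntegral h₂ p.2)

theorem under_center_eq (h : V = W.comap (algebraMap F E)) :
    (center h.le).under V = IsLocalRing.maximalIdeal V := by
  ext a
  rw [ValuationSubring.valuation_lt_one_iff V a]
  subst h
  rw [valuation_comap_lt_one_iff, Ideal.under_def, Ideal.mem_comap, mem_center_iff]
  rfl

theorem isInvariant_integralClosure [IsGalois F E] (V : ValuationSubring F) :
    Algebra.IsInvariant V (integralClosure V E) (E ≃ₐ[F] E) where
  isInvariant b hb := by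
    obtain ⟨a, ha⟩ := (InfiniteGalois.mem_range_algebraMap_iff_fixed (k := F) (b : E)).2
      fun σ => congrArg Subtype.val (hb σ)
    have hint : IsIntegral V (algebraMap F E a) := ha ▸ b.2
    rw [isIntegral_algebraMap_iff (algebraMap F E).injective] at hint
    obtain ⟨a, rfl⟩ := IsIntegrallyClosed.isIntegral_iff.1 hint
    exact ⟨a, Subtype.ext ha⟩

theorem exists_smul_center_eq [IsGalois F E] (h₁ : V = W₁.comap (algebraMap F E))
    (h₂ : V = W₂.comap (algebraMap F E)) :
    ∃ σ : E ≃ₐ[F] E, ∀ b, b ∈ center h₁.le ↔ σ • b ∈ center h₂.le := by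
  let : TopologicalSpace (integralClosure V E) := ⊥
  have : DiscreteTopology (integralClosure V E) := ⟨rfl⟩
  have : ContinuousSMul (E ≃ₐ[F] E) (integralClosure V E) := by
    refine continuousSMul_iff_stabilizer_isOpen.2 fun b => ?_
    convert! stabilizer_isOpen_of_isIntegral (K := F) (b : E) using 2
    ext σ
    exact Subtype.ext_iff
  have := isInvariant_integralClosure (E := E) V
  obtain ⟨σ, hσ⟩ := Algebra.IsInvariant.exists_smul_of_under_eq_of_profinite
    (A := V) (G := E ≃ₐ[F] E) (center h₁.le) (center h₂.le)
    ((under_center_eq h₁).trans (under_center_eq h₂).symm)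
  exact ⟨σ, fun b => by rw [hσ, Ideal.smul_mem_pointwise_smul_iff]⟩

theorem exists_comap_algEquiv_eq_of_isGalois [IsGalois F E]
    (h : W₁.comap (algebraMap F E) = W₂.comap (algebraMap F E)) :
    ∃ σ : E ≃ₐ[F] E, W₂.comap (σ : E →+* E) = W₁ := by
  obtain ⟨σ, hσ⟩ := exists_smul_center_eq (W₁ := W₁) (W₂ := W₂) rfl h
  have hle : W₁.comap (algebraMap F E) ≤
      (W₂.comap (σ : E →+* E)).comap (algebraMap F E) := fun a ha => by
    rw [h] at ha
    simpa only [ValuationSubring.mem_comap, RingHom.coe_coe, AlgEquiv.commutes] using ha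
  have center_eq : center hle = center le_rfl := by
    ext b
    rw [mem_center_iff, valuation_comap_lt_one_iff, hσ, mem_center_iff]
    rfl
  exact ⟨σ, le_antisymm (le_of_center_eq center_eq) (le_of_center_eq center_eq.symm)⟩

theorem exists_comap_algEquiv_eq [IsAlgClosed E] [Algebra.IsAlgebraic F E]
    (h : W₁.comap (algebraMap F E) = W₂.comap (algebraMap F E)) :
    ∃ σ : E ≃ₐ[F] E, W₂.comap (σ : E →+* E) = W₁ := by
  have : Algebra.IsAlgebraic (perfectClosure F E) E := Algebra.IsAlgebraic.tower_top (K := F) _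
  have : IsAlgClosure (perfectClosure F E) E := ⟨inferInstance, inferInstance⟩
  have : IsGalois (perfectClosure F E) E := {}
  have pow_mem_iff (W : ValuationSubring E) (x : E) (n : ℕ) :
      x ^ ringExpChar F ^ n ∈ W ↔ x ∈ W := by
    rw [← W.valuation_le_one_iff, ← W.valuation_le_one_iff, map_pow,
      pow_le_one_iff_of_nonneg zero_le (pow_ne_zero _ (expChar_pos F _).ne')]
  obtain ⟨σ, hσ⟩ := exists_comap_algEquiv_eq_of_isGalois (F := perfectClosure F E)
    (W₁ := W₁) (W₂ := W₂) (by
      ext ⟨x, hx⟩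
      obtain ⟨n, y, hy⟩ := mem_perfectClosure_iff.1 hx
      change x ∈ W₁ ↔ x ∈ W₂
      rw [← pow_mem_iff W₁ x n, ← pow_mem_iff W₂ x n, ← hy, ← ValuationSubring.mem_comap,
        ← ValuationSubring.mem_comap, h])
  exact ⟨σ.restrictScalars F, hσ⟩

end Conjugacy

section SameType

theorem exists_algebraicClosure_lift {F M : Type*} [Field F] [Field M] [IsAlgClosed M]
    (i : F →+* M) : ∃ j : AlgebraicClosure F →+* M, j.comp (algebraMap F _) = i := by
  algebraize [i]
  let j : AlgebraicClosure F →ₐ[F] M := IsAlgClosed.lift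
  exact ⟨j, j.comp_algebraMap⟩

universe u

variable {M N : Type*} [Field M] [Field N] {O : ValuationSubring M} {O' : ValuationSubring N}

theorem valuation_le_iff_of_comap_eq {E : Type*} [Field E] {i : E →+* M} {j : E →+* N}
    (h : O.comap i = O'.comap j) (x y : E) :
    O.valuation (i x) ≤ O.valuation (i y) ↔ O'.valuation (j x) ≤ O'.valuation (j y) := by
  by_cases hy : y = 0
  · simp [hy]
  have hM : 0 < O.valuation (i y) := zero_lt_iff.2 (by simpa using hy)
  have hN : 0 < O'.valuation (j y) := zero_lt_iff.2 (by simpa using hy)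
  rw [← div_le_one₀ hM, ← div_le_one₀ hN, ← map_div₀, ← map_div₀, ← map_div₀, ← map_div₀,
    O.valuation_le_one_iff, O'.valuation_le_one_iff, ← ValuationSubring.mem_comap, h,
    ValuationSubring.mem_comap]

variable {R : Type u} [CommRing R] {a : R →+* M} {b : R →+* N}

theorem exists_residueField_factorization
    (hab : ∀ f g, O.valuation (a f) ≤ O.valuation (a g) ↔ O'.valuation (b f) ≤ O'.valuation (b g)) :
    ∃ (F : Type u) (_ : Field F) (θ : R →+* F) (i : F →+* M) (j : F →+* N),
      i.comp θ = a ∧ j.comp θ = b ∧ O.comap i = O'.comap j := by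
  have ker_eq : RingHom.ker a = RingHom.ker b := by
    ext f
    simpa [RingHom.mem_ker] using hab f 0
  let P := RingHom.ker a
  have : P.IsPrime := RingHom.ker_isPrime a
  let i : P.ResidueField →+* M := Ideal.ResidueField.lift P a le_rfl
    fun f hf => IsUnit.mk0 (a f) hf
  let j : P.ResidueField →+* N := Ideal.ResidueField.lift P b ker_eq.le
    fun f hf => IsUnit.mk0 (b f) fun hbf => hf (ker_eq.ge hbf)
  have hi (f) : i (algebraMap R P.ResidueField f) = a f := Ideal.ResidueField.lift_algebraMap ..
  have hj (f) : j (algebraMap R P.ResidueField f) = b f := Ideal.ResidueField.lift_algebraMap ..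
  refine ⟨P.ResidueField, inferInstance, algebraMap R _, i, j, RingHom.ext hi, RingHom.ext hj, ?_⟩
  ext x
  obtain ⟨f, g, hg, rfl⟩ := IsFractionRing.div_surjective (R ⧸ P) x
  obtain ⟨f, rfl⟩ := Ideal.Quotient.mk_surjective f
  obtain ⟨g, rfl⟩ := Ideal.Quotient.mk_surjective g
  have hg0 : algebraMap R P.ResidueField g ≠ 0 := by
    simpa [Ideal.algebraMap_residueField_eq_zero, Ideal.Quotient.eq_zero_iff_mem] using
      nonZeroDivisors.ne_zero hg
  have ha : 0 < O.valuation (a g) := zero_lt_iff.2 (by simpa [← hi] using hg0)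
  have hb : 0 < O'.valuation (b g) := zero_lt_iff.2 (by simpa [← hj] using hg0)
  rw [ValuationSubring.mem_comap, ValuationSubring.mem_comap,
    Ideal.algebraMap_quotient_residueField_mk, Ideal.algebraMap_quotient_residueField_mk,
    map_div₀, map_div₀, hi, hi, hj, hj, ← O.valuation_le_one_iff, ← O'.valuation_le_one_iff,
    map_div₀, map_div₀, div_le_one₀ ha, div_le_one₀ hb]
  exact hab f g

variable [IsAlgClosed M] [IsAlgClosed N]

theorem exists_isAlgClosed_factorization
    (hab : ∀ f g, O.valuation (a f) ≤ O.valuation (a g) ↔ O'.valuation (b f) ≤ O'.valuation (b g)) :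
    ∃ (E : Type u) (_ : Field E) (_ : IsAlgClosed E) (θ : R →+* E) (i : E →+* M) (j : E →+* N),
      i.comp θ = a ∧ j.comp θ = b ∧ O.comap i = O'.comap j := by
  obtain ⟨F, _, θ, i₀, j₀, rfl, rfl, h⟩ := exists_residueField_factorization hab
  obtain ⟨i, rfl⟩ := exists_algebraicClosure_lift i₀
  obtain ⟨j, rfl⟩ := exists_algebraicClosure_lift j₀
  rw [← ValuationSubring.comap_comap, ← ValuationSubring.comap_comap] at h
  obtain ⟨σ, hσ⟩ := exists_comap_algEquiv_eq h
  refine ⟨AlgebraicClosure F, inferInstance, inferInstance, (algebraMap F _).comp θ, i,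
    j.comp (σ : AlgebraicClosure F →+* AlgebraicClosure F), rfl, ?_, ?_⟩
  · ext f
    simp
  · rw [← hσ, ValuationSubring.comap_comap]

theorem exists_le_valuation_eval₂_iff
    (hab : ∀ f g, O.valuation (a f) ≤ O.valuation (a g) ↔ O'.valuation (b f) ≤ O'.valuation (b g))
    (ha : ∃ r, a r ≠ 0 ∧ O.valuation (a r) ≠ 1) (s : Finset (Polynomial R × Polynomial R)) (x : M) :
    ∃ y : N, ∀ p ∈ s, (O.valuation (p.1.eval₂ a x) ≤ O.valuation (p.2.eval₂ a x) ↔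
      O'.valuation (p.1.eval₂ b y) ≤ O'.valuation (p.2.eval₂ b y)) := by
  classical
  obtain ⟨E, _, _, θ, i, j, rfl, rfl, h⟩ := exists_isAlgClosed_factorization hab
  obtain ⟨r, hr0, hr1⟩ := ha
  obtain ⟨y, hy⟩ := exists_le_map_eval_iff O.valuation i
    ⟨θ r, fun h0 => hr0 (by rw [RingHom.comp_apply, h0, map_zero]), hr1⟩
    (s.image (Prod.map (Polynomial.map θ) (Polynomial.map θ))) x
  refine ⟨j y, fun p hp => ?_⟩
  have hyp := hy _ (Finset.mem_image_of_mem _ hp)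
  rw [valuation_le_iff_of_comap_eq h, ← Polynomial.eval₂_at_apply,
    ← Polynomial.eval₂_at_apply] at hyp
  simpa only [Prod.map_fst, Prod.map_snd, Polynomial.eval₂_map] using hyp

end SameType

section Ultrapower

variable {I L : Type*} [Field L] (W : Ultrafilter I)

open Filter

theorem eval_pi_apply (q : Polynomial (I → L)) (z : I → L) (t : I) :
    q.eval z t = (q.map (Pi.evalRingHom _ t)).eval (z t) := by
  rw [Polynomial.eval_map]
  exact Polynomial.hom_eval₂ q (RingHom.id _) (Pi.evalRingHom (fun _ => L) t) z

instance isAlgClosed_germ [IsAlgClosed L] : IsAlgClosed (Germ (W : Filter I) L) := by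
  refine IsAlgClosed.of_exists_root _ fun p monic_p irreducible_p => ?_
  have mem_lifts : p ∈ Polynomial.lifts (Germ.coeRingHom (R := L) (W : Filter I)) :=
    (Polynomial.lifts_iff_coeff_lifts p).2 fun l => Quotient.exists_rep (p.coeff l)
  obtain ⟨q, rfl, natDegree_q, monic_q⟩ :=
    Polynomial.lifts_and_natDegree_eq_and_monic mem_lifts monic_p
  have exists_root (t) : ∃ z, (q.map (Pi.evalRingHom _ t)).eval z = 0 := by
    refine IsAlgClosed.exists_root _ fun h0 => irreducible_p.natDegree_pos.ne' ?_
    rw [← natDegree_q, ← monic_q.natDegree_map (Pi.evalRingHom _ t)]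
    exact Polynomial.natDegree_eq_of_degree_eq_some h0
  choose z hz using exists_root
  refine ⟨Germ.coeRingHom (W : Filter I) z, ?_⟩
  have eval_z : q.eval z = 0 := funext fun t => (eval_pi_apply q z t).trans (hz t)
  rw [Polynomial.eval_map, Polynomial.eval₂_at_apply, eval_z, map_zero]

/-- The valuation ring of the ultrapower along `W` of a field with valuation ring `O`. -/
def ultrapowerSubring (O : ValuationSubring L) : ValuationSubring (Germ (W : Filter I) L) where
  carrier := {x | x.LiftPred (· ∈ O)}
  zero_mem' := Eventually.of_forall fun _ => O.zero_mem
  one_mem' := Eventually.of_forall fun _ => O.one_mem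
  add_mem' {x y} := Germ.inductionOn₂ x y fun _ _ hf hg => by
    filter_upwards [hf, hg] using fun _ => O.add_mem _ _
  mul_mem' {x y} := Germ.inductionOn₂ x y fun _ _ hf hg => by
    filter_upwards [hf, hg] using fun _ => O.mul_mem _ _
  neg_mem' {x} := Germ.inductionOn x fun _ hf => hf.mono fun _ => O.neg_mem _
  mem_or_inv_mem' x := Germ.inductionOn x fun f =>
    Ultrafilter.eventually_or.1 (Eventually.of_forall fun t => O.mem_or_inv_mem (f t))

theorem ultrapowerSubring_valuation_le_iff {O : ValuationSubring L} {f g : I → L} :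
    (ultrapowerSubring W O).valuation (f : Germ (W : Filter I) L) ≤
      (ultrapowerSubring W O).valuation (g : Germ (W : Filter I) L) ↔
    ∀ᶠ t in (W : Filter I), O.valuation (f t) ≤ O.valuation (g t) := by
  simp only [ValuationSubring.valuation_le_iff]
  constructor
  · rintro ⟨⟨a, ha⟩, h⟩
    induction a using Germ.inductionOn with
    | h a =>
      filter_upwards [Germ.coe_eq.1 h, ha] with t hat hmem using ⟨⟨a t, hmem⟩, hat⟩
  · intro h
    obtain ⟨a, ha⟩ := h.choice
    exact ⟨⟨((fun t => (a t : L)) : I → L), Eventually.of_forall fun t => (a t).2⟩,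
      Germ.coe_eq.2 ha⟩

theorem ultrapowerSubring_valuation_eq_iff {O : ValuationSubring L} {f g : I → L} :
    (ultrapowerSubring W O).valuation (f : Germ (W : Filter I) L) =
      (ultrapowerSubring W O).valuation (g : Germ (W : Filter I) L) ↔
    ∀ᶠ t in (W : Filter I), O.valuation (f t) = O.valuation (g t) := by
  simp only [le_antisymm_iff, eventually_and, ultrapowerSubring_valuation_le_iff]

variable {ι : Type*}

/-- Evaluation of polynomials at the point of an ultrapower represented by a family of points. -/
noncomputable def evalGerm (x : I → ι → L) : MvPolynomial ι L →+* Germ (W : Filter I) L :=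
  (Germ.coeRingHom (W : Filter I)).comp (RingHom.pi fun t => MvPolynomial.eval (x t))

theorem eval₂_evalGerm (x : I → ι → L) (p : MvPolynomial (Option ι) L) (a : I → L) :
    (MvPolynomial.optionEquivLeft L ι p).eval₂ (evalGerm W x) (a : Germ (W : Filter I) L) =
      ((fun t => p.eval fun o => o.elim (a t) (x t) : I → L) : Germ (W : Filter I) L) := by
  rw [evalGerm, ← Polynomial.eval₂_map]
  refine (Polynomial.eval₂_at_apply (Germ.coeRingHom (W : Filter I)) a).trans ?_
  refine congrArg (Germ.coeRingHom (W : Filter I)) (funext fun t => ?_)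
  rw [MvPolynomial.optionEquivLeft_elim_eval, eval_pi_apply, Polynomial.map_map]
  rfl

end Ultrapower

section ValuedFields

variable {L : Type*} [Field L] {O : ValuationSubring L}

open Filter (Germ)

/-- The family of the sets defined by comparing the values of two polynomials. -/
def comparisonFamily (O : ValuationSubring L) (ι : Type*) :
    MvPolynomial ι L × MvPolynomial ι L → Set (ι → L) :=
  fun p => {z | O.valuation (p.1.eval z) ≤ O.valuation (p.2.eval z)}

theorem eventually_iff_iff {I : Type*} {W : Ultrafilter I} {P Q : I → Prop} :
    (∀ᶠ t in (W : Filter I), (P t ↔ Q t)) ↔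
      ((∀ᶠ t in (W : Filter I), P t) ↔ ∀ᶠ t in (W : Filter I), Q t) := by
  simp only [iff_iff_implies_and_implies, Filter.eventually_and, Ultrafilter.eventually_imp]

variable {ι : Type*}

theorem exists_valuation_evalGerm_ne_one (hO : ∃ e : L, e ≠ 0 ∧ O.valuation e ≠ 1) {I : Type*}
    (W : Ultrafilter I) (x : I → ι → L) :
    ∃ f, evalGerm W x f ≠ 0 ∧ (ultrapowerSubring W O).valuation (evalGerm W x f) ≠ 1 := by
  obtain ⟨e, he0, he1⟩ := hO
  have valuation_C_eq_iff (c : L) : (ultrapowerSubring W O).valuation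
      (evalGerm W x (MvPolynomial.C e)) = (ultrapowerSubring W O).valuation (c : Germ _ L) ↔
        O.valuation e = O.valuation c := by
    refine (ultrapowerSubring_valuation_eq_iff (g := fun _ => c) W).trans ?_
    simp only [MvPolynomial.eval_C, RingHom.pi_apply, Filter.eventually_const]
  refine ⟨MvPolynomial.C e, fun h0 => he0 ?_, fun h1 => he1 ?_⟩
  · rw [← map_eq_zero O.valuation, ← map_zero O.valuation, ← valuation_C_eq_iff, h0]
    rfl
  · rw [← map_one O.valuation, ← valuation_C_eq_iff, h1]
    exact (map_one _).symm

variable [IsAlgClosed L]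

theorem exists_eventually_mem_comparisonFamily_iff (hO : ∃ e : L, e ≠ 0 ∧ O.valuation e ≠ 1)
    {I : Type*} {W : Ultrafilter I} {x y : I → ι → L}
    (hxy : ∀ p, ∀ᶠ t in (W : Filter I),
      (x t ∈ comparisonFamily O ι p ↔ y t ∈ comparisonFamily O ι p))
    (s : Finset (MvPolynomial (Option ι) L × MvPolynomial (Option ι) L)) (a : I → L) :
    ∃ b : I → L, ∀ᶠ t in (W : Filter I), ∀ p ∈ s,
      ((fun o : Option ι => o.elim (a t) (x t)) ∈ comparisonFamily O (Option ι) p ↔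
        (fun o : Option ι => o.elim (b t) (y t)) ∈ comparisonFamily O (Option ι) p) := by
  classical
  have le_iff (f g) : (ultrapowerSubring W O).valuation (evalGerm W x f) ≤
      (ultrapowerSubring W O).valuation (evalGerm W x g) ↔
      (ultrapowerSubring W O).valuation (evalGerm W y f) ≤
      (ultrapowerSubring W O).valuation (evalGerm W y g) :=
    (ultrapowerSubring_valuation_le_iff W).trans <|
      (Filter.eventually_congr (hxy (f, g))).trans (ultrapowerSubring_valuation_le_iff W).symm
  let toPoly := MvPolynomial.optionEquivLeft L ι
  obtain ⟨b, hb⟩ := exists_le_valuation_eval₂_iff le_iff (exists_valuation_evalGerm_ne_one hO W x)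
    (s.image (Prod.map toPoly toPoly)) (a : Germ (W : Filter I) L)
  induction b using Germ.inductionOn with
  | h b =>
    refine ⟨b, (Filter.eventually_all_finset s).2 fun p hp => eventually_iff_iff.2 ?_⟩
    have le_iff_le := hb _ (Finset.mem_image_of_mem _ hp)
    simp only [Prod.map_fst, Prod.map_snd, toPoly, eval₂_evalGerm,
      ultrapowerSubring_valuation_le_iff] at le_iff_le
    exact le_iff_le

theorem finitelyDetermined_projection (hO : ∃ e : L, e ≠ 0 ∧ O.valuation e ≠ 1)
    {S : Set (Option ι → L)} (hS : FinitelyDetermined (comparisonFamily O (Option ι)) S) :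
    FinitelyDetermined (comparisonFamily O ι)
      {z | ∃ a, (fun o : Option ι => o.elim a z) ∈ S} := by
  by_contra not_determined
  obtain ⟨W, x, y, hx, hy, hxy⟩ := exists_ultrafilter_of_not_finitelyDetermined not_determined
  obtain ⟨s, hs⟩ := hS
  choose a ha using hx
  obtain ⟨b, hb⟩ := exists_eventually_mem_comparisonFamily_iff hO hxy s a
  obtain ⟨t, ht⟩ := hb.exists
  exact hy t ⟨b t, hs _ _ ht (ha t)⟩

end ValuedFields

section ValuationRing

variable {F : Type*} {Γ : Type*} [Field F] [AddCommGroup Γ] [LinearOrder Γ] [IsOrderedAddMonoid Γ]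
  (v : AddValuation F (WithTop Γ))

/-- The valuation ring of an additively written valuation. -/
def valuationRing : ValuationSubring F :=
  (AddValuation.toValuation v).valuationSubring

theorem valuationRing_valuation_le_iff (x y : F) :
    (valuationRing v).valuation x ≤ (valuationRing v).valuation y ↔ v y ≤ v x :=
  (AddValuation.toValuation v).isEquiv_valuation_valuationSubring.symm x y

theorem valuationRing_valuation_lt_iff (x y : F) :
    (valuationRing v).valuation x < (valuationRing v).valuation y ↔ v y < v x := by
  rw [← not_le, ← not_le, valuationRing_valuation_le_iff]

theorem IsModel.exists_valuationRing_valuation_ne_one {v : AddValuation F (WithTop Γ)}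
    (hv : IsModel v) : ∃ e : F, e ≠ 0 ∧ (valuationRing v).valuation e ≠ 1 := by
  obtain ⟨e, he0, he⟩ := hv.nontrivial
  refine ⟨e, he0, fun h => he ?_⟩
  rw [← map_one (valuationRing v).valuation] at h
  rw [← v.map_one]
  exact le_antisymm ((valuationRing_valuation_le_iff v 1 e).1 h.ge)
    ((valuationRing_valuation_le_iff v e 1).1 h.le)

end ValuationRing

section DefinableSets

universe u v w

theorem definable_rel₂ {𝓛 : FirstOrder.Language.{u, v}} {M : Type w} [𝓛.Structure M] {α : Type*}
    (R : 𝓛.Relations 2) (t₁ t₂ : 𝓛.Term (M ⊕ α)) :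
    (Set.univ : Set M).Definable 𝓛 {z : α → M | Structure.RelMap R
      ![t₁.realize (Sum.elim id z), t₂.realize (Sum.elim id z)]} := by
  rw [Set.definable_iff_exists_formula_sum]
  let r : M ⊕ α → (Set.univ : Set M) ⊕ α := Sum.map (fun a => ⟨a, trivial⟩) id
  refine ⟨R.formula₂ (t₁.relabel r) (t₂.relabel r), ?_⟩
  ext z
  have elim_comp : Sum.elim (fun a : (Set.univ : Set M) => (a : M)) z ∘ r = Sum.elim id z := by
    ext (a | a) <;> rfl
  simp only [Set.mem_ofPred_eq, Formula.realize_rel₂, Term.realize_relabel, elim_comp]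

variable {F : Type*} {Γ : Type*} [Field F] [AddCommGroup Γ] [LinearOrder Γ] [IsOrderedAddMonoid Γ]
  (v : AddValuation F (WithTop Γ))

theorem exists_polynomial_of_term {ι : Type*}
    (t : letI := valuedFieldStructure v; ldiv.Term (F ⊕ ι)) :
    letI := valuedFieldStructure v
    ∃ f : MvPolynomial ι F, ∀ z : ι → F, t.realize (Sum.elim id z) = f.eval z := by
  let := valuedFieldStructure v
  induction t with
  | var x =>
    rcases x with a | l
    · exact ⟨MvPolynomial.C a, fun z => by simp⟩
    · exact ⟨MvPolynomial.X l, fun z => by simp⟩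
  | func f ts ih =>
    choose p hp using ih
    cases f with
    | add => exact ⟨p 0 + p 1, fun z => by rw [map_add, ← hp, ← hp]; rfl⟩
    | mul => exact ⟨p 0 * p 1, fun z => by rw [map_mul, ← hp, ← hp]; rfl⟩
    | neg => exact ⟨-p 0, fun z => by rw [map_neg, ← hp]; rfl⟩
    | zero => exact ⟨0, fun z => by rw [map_zero]; rfl⟩
    | one => exact ⟨1, fun z => by rw [map_one]; rfl⟩

theorem IsModel.eliminatesQuantifiers {v : AddValuation F (WithTop Γ)} (hv : IsModel v) :
    letI := valuedFieldStructure v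
    EliminatesQuantifiers ldiv fun ι : Type => comparisonFamily (valuationRing v) ι := by
  let := valuedFieldStructure v
  have := hv.isAlgClosed
  refine ⟨?_, finitelyDetermined_projection hv.exists_valuationRing_valuation_ne_one, ?_, ?_⟩
  · intro ι ι' g p
    convert FinitelyDetermined.of_mem_family (comparisonFamily (valuationRing v) ι')
      (MvPolynomial.rename g p.1, MvPolynomial.rename g p.2) using 1
    ext z
    simp only [comparisonFamily, Set.mem_ofPred_eq, MvPolynomial.eval_rename]
  · intro ι t₁ t₂
    obtain ⟨f₁, h₁⟩ := exists_polynomial_of_term v t₁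
    obtain ⟨f₂, h₂⟩ := exists_polynomial_of_term v t₂
    convert FinitelyDetermined.of_mem_family (comparisonFamily (valuationRing v) ι)
      (f₁ - f₂, 0) using 1
    ext z
    simp [comparisonFamily, h₁, h₂, sub_eq_zero]
  · rintro ι n ⟨⟩ ts
    choose f hf using fun l => exists_polynomial_of_term v (ts l)
    convert FinitelyDetermined.of_mem_family (comparisonFamily (valuationRing v) ι)
      (f 1, f 0) using 1
    ext z
    simp only [comparisonFamily, Set.mem_ofPred_eq, valuationRing_valuation_le_iff, hf]
    rfl

theorem eval₂_aeval_X (f : MvPolynomial (Fin 1) F) (z : Fin 1 → F) :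
    (MvPolynomial.aeval (fun _ => (Polynomial.X : Polynomial F)) f).eval₂ (RingHom.id F) (z 0) =
      f.eval z := by
  induction f using MvPolynomial.induction_on with
  | C a => simp
  | add p q hp hq => simp only [map_add, Polynomial.eval₂_add, hp, hq]
  | mul_X p i hp =>
    simp only [map_mul, Polynomial.eval₂_mul, hp, MvPolynomial.aeval_X, Polynomial.eval₂_X,
      MvPolynomial.eval_X, Subsingleton.elim i 0]

theorem IsModel.finitelyDetermined_ballFamily {v : AddValuation F (WithTop Γ)} (hv : IsModel v)
    {C : Set F} {S : Set (Fin 1 → F)} (hS : letI := valuedFieldStructure v; C.Definable ldiv S) :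
    FinitelyDetermined (fun k => (fun z : Fin 1 → F => z 0) ⁻¹'
      ballFamily (valuationRing v).valuation (RingHom.id F) k) S := by
  classical
  let := valuedFieldStructure v
  have := hv.isAlgClosed
  refine (hv.eliminatesQuantifiers.finitelyDetermined_of_definable hS).trans fun p => ?_
  let toPoly := MvPolynomial.aeval (R := F) fun _ : Fin 1 => (Polynomial.X : Polynomial F)
  convert (finitelyDetermined_polynomial (valuationRing v).valuation (RingHom.id F) (toPoly p.1)
    (toPoly p.2)).preimage (fun z : Fin 1 → F => z 0) using 1
  ext z
  simp only [Set.mem_preimage, Set.mem_ofPred_eq, toPoly, eval₂_aeval_X]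
  rfl

theorem exists_term_realize_eq_sub (a : F) :
    letI := valuedFieldStructure v
    ∃ t : ldiv.Term (F ⊕ Fin 1), ∀ z : Fin 1 → F, t.realize (Sum.elim id z) = z 0 - a := by
  let := valuedFieldStructure v
  refine ⟨Functions.apply₂ (L := ldiv) ringFunc.add (Term.var (Sum.inr 0))
    (Functions.apply₁ (L := ldiv) ringFunc.neg (Term.var (Sum.inl a))), fun z => ?_⟩
  rw [sub_eq_add_neg]
  rfl

theorem definable_le_map_sub (e a : F) :
    letI := valuedFieldStructure v
    (Set.univ : Set F).Definable ldiv {z : Fin 1 → F | v e ≤ v (z 0 - a)} := by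
  let := valuedFieldStructure v
  obtain ⟨t, ht⟩ := exists_term_realize_eq_sub v a
  have definable := definable_rel₂ DivRel.div (Term.var (Sum.inl e)) t
  simp only [ht] at definable
  exact definable

theorem definable_lt_map_sub (e a : F) :
    letI := valuedFieldStructure v
    (Set.univ : Set F).Definable ldiv {z : Fin 1 → F | v e < v (z 0 - a)} := by
  let := valuedFieldStructure v
  obtain ⟨t, ht⟩ := exists_term_realize_eq_sub v a
  have definable := (definable_rel₂ DivRel.div t (Term.var (Sum.inl e))).compl
  simp only [ht] at definable
  simp only [← not_le]
  exact definable

end DefinableSets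

section DivisibleGroups

variable {G ι : Type*} [AddCommGroup G]

/-- The affine functions with integer coefficients, given by a constant and a linear part,
evaluated at the point `z`. -/
noncomputable def affineFun (z : ι → G) : G × (ι →₀ ℤ) →+ G :=
  AddMonoidHom.coprod (AddMonoidHom.id G) (Finsupp.linearCombination ℤ z).toAddMonoidHom

theorem affineFun_apply (z : ι → G) (p : G × (ι →₀ ℤ)) :
    affineFun z p = p.1 + Finsupp.linearCombination ℤ z p.2 := rfl

theorem affineFun_option (z : ι → G) (a : G) (p : G × (Option ι →₀ ℤ)) :
    affineFun (fun o : Option ι => o.elim a z) p =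
      affineFun z (p.1, p.2.some) + p.2 none • a := by
  rw [affineFun_apply, affineFun_apply, Finsupp.linearCombination_option, add_assoc,
    add_comm (p.2 none • _)]
  rfl

/-- The root of an affine function in the new variable `none`, as a function of the others. It is
a junk value if the coefficient of the new variable is `0`. -/
noncomputable def criticalPoint [DivisibleBy G ℤ] (z : ι → G) (p : G × (Option ι →₀ ℤ)) : G :=
  DivisibleBy.div (-affineFun z (p.1, p.2.some)) (p.2 none)

/-- The affine function whose sign compares the critical points of `p` and `r`. The factors are
arranged so that no case distinction on the signs of the coefficients is needed. -/
noncomputable def criticalDifference (p r : G × (Option ι →₀ ℤ)) : G × (ι →₀ ℤ) :=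
  (p.2 none * r.2 none ^ 2) • (p.1, p.2.some) - (r.2 none * p.2 none ^ 2) • (r.1, r.2.some)

theorem zsmul_criticalPoint [DivisibleBy G ℤ] (z : ι → G) {p : G × (Option ι →₀ ℤ)}
    (hp : p.2 none ≠ 0) : p.2 none • criticalPoint z p = -affineFun z (p.1, p.2.some) :=
  DivisibleBy.div_cancel _ hp

variable [LinearOrder G]

/-- The family of the half-spaces defined by affine functions with integer coefficients. -/
def halfspaceFamily (G ι : Type*) [AddCommGroup G] [LinearOrder G] :
    G × (ι →₀ ℤ) → Set (ι → G) :=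
  fun p => {z | 0 ≤ affineFun z p}

theorem exists_affineFun_of_term (t : oag.Term (G ⊕ ι)) :
    ∃ p : G × (ι →₀ ℤ), ∀ z : ι → G, t.realize (Sum.elim id z) = affineFun z p := by
  induction t with
  | var x =>
    rcases x with a | l
    · exact ⟨(a, 0), fun z => by simp [affineFun_apply]⟩
    · exact ⟨(0, Finsupp.single l 1), fun z => by simp [affineFun_apply]⟩
  | func f ts ih =>
    choose p hp using ih
    cases f with
    | add => exact ⟨p 0 + p 1, fun z => by rw [map_add, ← hp, ← hp]; rfl⟩
    | neg => exact ⟨-p 0, fun z => by rw [map_neg, ← hp]; rfl⟩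
    | zero => exact ⟨0, fun z => by rw [map_zero]; rfl⟩

theorem exists_term_realize_eq_zsmul (l : ι) (n : ℤ) :
    ∃ t : oag.Term (G ⊕ ι), ∀ z : ι → G, t.realize (Sum.elim id z) = n • z l := by
  induction n with
  | zero => exact ⟨Term.func GroupFunc.zero ![], fun z => by rw [zero_smul]; rfl⟩
  | succ n ih =>
    obtain ⟨t, ht⟩ := ih
    refine ⟨Functions.apply₂ (L := oag) GroupFunc.add t (Term.var (Sum.inr l)), fun z => ?_⟩
    rw [add_zsmul, one_zsmul, ← ht]
    rfl
  | pred n ih =>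
    obtain ⟨t, ht⟩ := ih
    refine ⟨Functions.apply₂ (L := oag) GroupFunc.add t
      (Functions.apply₁ (L := oag) GroupFunc.neg (Term.var (Sum.inr l))), fun z => ?_⟩
    rw [sub_zsmul, one_zsmul, ← ht]
    rfl

theorem exists_term_realize_eq_linearCombination (q : ι →₀ ℤ) :
    ∃ t : oag.Term (G ⊕ ι), ∀ z : ι → G,
      t.realize (Sum.elim id z) = Finsupp.linearCombination ℤ z q := by
  induction q using Finsupp.induction_linear with
  | zero => exact ⟨Term.func GroupFunc.zero ![], fun z => by rw [map_zero]; rfl⟩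
  | add p q hp hq =>
    obtain ⟨t, ht⟩ := hp
    obtain ⟨t', ht'⟩ := hq
    exact ⟨Functions.apply₂ (L := oag) GroupFunc.add t t',
      fun z => by rw [map_add, ← ht, ← ht']; rfl⟩
  | single l n =>
    simpa only [Finsupp.linearCombination_single] using exists_term_realize_eq_zsmul l n

variable [IsOrderedAddMonoid G]

section Divisible

variable [DivisibleBy G ℤ]

theorem criticalPoint_le_iff {p : G × (Option ι →₀ ℤ)} (hp : 0 < p.2 none) (z : ι → G) (a : G) :
    criticalPoint z p ≤ a ↔ 0 ≤ affineFun (fun o : Option ι => o.elim a z) p := by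
  rw [affineFun_option, ← neg_le_iff_add_nonneg', ← zsmul_criticalPoint z hp.ne',
    zsmul_le_zsmul_iff_right hp]

theorem le_criticalPoint_iff {p : G × (Option ι →₀ ℤ)} (hp : p.2 none < 0) (z : ι → G) (a : G) :
    a ≤ criticalPoint z p ↔ 0 ≤ affineFun (fun o : Option ι => o.elim a z) p := by
  rw [affineFun_option, ← neg_le_iff_add_nonneg', ← zsmul_criticalPoint z hp.ne,
    ← neg_le_neg_iff (a := _ • _), ← neg_smul, ← neg_smul, zsmul_le_zsmul_iff_right (neg_pos.2 hp)]

theorem criticalPoint_le_criticalPoint_iff {p r : G × (Option ι →₀ ℤ)} (hp : p.2 none ≠ 0)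
    (hr : r.2 none ≠ 0) (z : ι → G) :
    criticalPoint z p ≤ criticalPoint z r ↔ z ∈ halfspaceFamily G ι (criticalDifference p r) := by
  have pos : 0 < p.2 none ^ 2 * r.2 none ^ 2 := by positivity
  have affineFun_p : affineFun z (p.1, p.2.some) = -(p.2 none • criticalPoint z p) := by
    rw [zsmul_criticalPoint z hp, neg_neg]
  have affineFun_r : affineFun z (r.1, r.2.some) = -(r.2 none • criticalPoint z r) := by
    rw [zsmul_criticalPoint z hr, neg_neg]
  rw [halfspaceFamily, Set.mem_ofPred_eq, criticalDifference, map_sub, map_zsmul, map_zsmul,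
    affineFun_p, affineFun_r, ← zsmul_le_zsmul_iff_right pos, ← sub_nonneg]
  refine iff_of_eq (congrArg (0 ≤ ·) ?_)
  module

theorem finitelyDetermined_halfspaceFamily_projection [Nontrivial G] {S : Set (Option ι → G)}
    (hS : FinitelyDetermined (halfspaceFamily G (Option ι)) S) :
    FinitelyDetermined (halfspaceFamily G ι) {z | ∃ a, (fun o : Option ι => o.elim a z) ∈ S} := by
  classical
  have : DenselyOrdered G := denselyOrdered_of_exists_two_nsmul_eq fun a =>
    ⟨DivisibleBy.div a (2 : ℤ), by
      rw [← natCast_zsmul]; exact DivisibleBy.div_cancel a two_ne_zero⟩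
  obtain ⟨s, hs⟩ := hS
  refine ⟨s.image (fun p => (p.1, p.2.some)) ∪ (s ×ˢ s).image fun q => criticalDifference q.1 q.2,
    ?_⟩
  rintro x y hxy ⟨a, ha⟩
  have cmp_criticalPoint : ∀ p ∈ s.filter (·.2 none ≠ 0), ∀ r ∈ s.filter (·.2 none ≠ 0),
      cmp (criticalPoint x p) (criticalPoint x r) =
        cmp (criticalPoint y p) (criticalPoint y r) := by
    have le_iff : ∀ p ∈ s.filter (·.2 none ≠ 0), ∀ r ∈ s.filter (·.2 none ≠ 0),
        (criticalPoint x p ≤ criticalPoint x r ↔ criticalPoint y p ≤ criticalPoint y r) := by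
      intro p hp r hr
      rw [Finset.mem_filter] at hp hr
      rw [criticalPoint_le_criticalPoint_iff hp.2 hr.2,
        criticalPoint_le_criticalPoint_iff hp.2 hr.2]
      exact hxy _ (Finset.mem_union_right _
        (Finset.mem_image_of_mem _ (Finset.mk_mem_product hp.1 hr.1)))
    exact fun p hp r hr => cmp_eq_cmp_iff.2
      ⟨le_iff p hp r hr, lt_iff_lt_of_le_iff_le (le_iff r hr p hp)⟩
  obtain ⟨b, hb⟩ := exists_cmp_eq_of_finset cmp_criticalPoint a
  refine ⟨b, hs _ _ (fun p hp => ?_) ha⟩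
  have cmp_eq (h : p.2 none ≠ 0) := hb p (Finset.mem_filter.2 ⟨hp, h⟩)
  simp only [halfspaceFamily, Set.mem_ofPred_eq]
  rcases lt_trichotomy (p.2 none) 0 with h | h | h
  · rw [← le_criticalPoint_iff h, ← le_criticalPoint_iff h]
    exact le_iff_le_of_cmp_eq_cmp (cmp_eq h.ne)
  · simp only [affineFun_option, h, zero_smul, add_zero]
    exact hxy _ (Finset.mem_union_left _ (Finset.mem_image_of_mem _ hp))
  · rw [← criticalPoint_le_iff h, ← criticalPoint_le_iff h]
    exact le_iff_le_of_cmp_eq_cmp (cmp_eq_cmp_symm.1 (cmp_eq h.ne'))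

end Divisible

theorem eliminatesQuantifiers_halfspaceFamily [DivisibleBy G ℤ] [Nontrivial G] :
    EliminatesQuantifiers oag fun ι : Type => halfspaceFamily G ι := by
  refine ⟨?_, finitelyDetermined_halfspaceFamily_projection, ?_, ?_⟩
  · intro ι ι' g p
    convert FinitelyDetermined.of_mem_family (halfspaceFamily G ι') (p.1, p.2.mapDomain g) using 1
    ext z
    simp only [halfspaceFamily, Set.mem_ofPred_eq, affineFun_apply,
      Finsupp.linearCombination_mapDomain]
  · intro ι t₁ t₂
    obtain ⟨p₁, h₁⟩ := exists_affineFun_of_term t₁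
    obtain ⟨p₂, h₂⟩ := exists_affineFun_of_term t₂
    convert (FinitelyDetermined.of_mem_family (halfspaceFamily G ι) (p₁ - p₂)).inter
      (FinitelyDetermined.of_mem_family (halfspaceFamily G ι) (p₂ - p₁)) using 1
    ext z
    simp only [halfspaceFamily, Set.mem_ofPred_eq, Set.mem_inter_iff, map_sub, sub_nonneg, h₁, h₂]
    rw [and_comm, le_antisymm_iff]
  · rintro ι n ⟨⟩ ts
    choose p hp using fun l => exists_affineFun_of_term (ts l)
    convert FinitelyDetermined.of_mem_family (halfspaceFamily G ι) (p 1 - p 0) using 1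
    ext z
    simp only [halfspaceFamily, Set.mem_ofPred_eq, map_sub, sub_nonneg, hp]
    rfl

end DivisibleGroups

section Cuts

variable {Γ : Type*} [LinearOrder Γ] {S : Set Γ} {γ : Γ}

/-- The cut which `γ` defines in `S` is trivial or has an endpoint in `S`, so that the condition
`γ ≤ δ` on `δ ∈ S` can be expressed by a comparison of `δ` with an element of `S`. -/
def HasEndpoint (S : Set Γ) (γ : Γ) : Prop :=
  (∀ δ ∈ S, γ ≤ δ) ∨ (∀ δ ∈ S, δ < γ) ∨ (∃ c ∈ S, ∀ δ ∈ S, γ ≤ δ ↔ c ≤ δ) ∨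
    ∃ c ∈ S, ∀ δ ∈ S, γ ≤ δ ↔ c < δ

theorem hasEndpoint_of_finset_above {Δ : Finset Γ} (hΔ : ∀ d ∈ Δ, d ∈ S)
    (h : ∀ δ ∈ S, γ ≤ δ → ∃ d ∈ Δ, γ ≤ d ∧ d ≤ δ) : HasEndpoint S γ := by
  rcases (Δ.filter (γ ≤ ·)).eq_empty_or_nonempty with empty | nonempty
  · refine .inr (.inl fun δ hδ => not_le.1 fun hle => ?_)
    obtain ⟨d, hd, hγd, -⟩ := h δ hδ hle
    exact Finset.filter_eq_empty_iff.1 empty hd hγd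
  · obtain ⟨c, hc, c_le⟩ := (Δ.filter (γ ≤ ·)).exists_min_image id nonempty
    rw [Finset.mem_filter] at hc
    refine .inr (.inr (.inl ⟨c, hΔ c hc.1, fun δ hδ => ⟨fun hle => ?_, hc.2.trans⟩⟩))
    obtain ⟨d, hd, hγd, hdδ⟩ := h δ hδ hle
    exact (c_le d (Finset.mem_filter.2 ⟨hd, hγd⟩)).trans hdδ

theorem hasEndpoint_of_finset_below {Δ : Finset Γ} (hΔ : ∀ d ∈ Δ, d ∈ S)
    (h : ∀ δ ∈ S, δ < γ → ∃ d ∈ Δ, δ ≤ d ∧ d < γ) : HasEndpoint S γ := by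
  rcases (Δ.filter (· < γ)).eq_empty_or_nonempty with empty | nonempty
  · refine .inl fun δ hδ => not_lt.1 fun hlt => ?_
    obtain ⟨d, hd, -, hdγ⟩ := h δ hδ hlt
    exact Finset.filter_eq_empty_iff.1 empty hd hdγ
  · obtain ⟨c, hc, le_c⟩ := (Δ.filter (· < γ)).exists_max_image id nonempty
    rw [Finset.mem_filter] at hc
    refine .inr (.inr (.inr ⟨c, hΔ c hc.1, fun δ hδ => ⟨hc.2.trans_le, fun hcδ => ?_⟩⟩))
    refine not_lt.1 fun hlt => hcδ.not_ge ?_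
    obtain ⟨d, hd, hδd, hdγ⟩ := h δ hδ hlt
    exact hδd.trans (le_c d (Finset.mem_filter.2 ⟨hd, hdγ⟩))

theorem hasEndpoint_of_finset {Δ : Finset Γ} (hΔ : ∀ d ∈ Δ, d ∈ S)
    (h : ∀ δ₁ ∈ S, ∀ δ₂ ∈ S, δ₁ < γ → γ ≤ δ₂ → ∃ d ∈ Δ, δ₁ ≤ d ∧ d ≤ δ₂) : HasEndpoint S γ := by
  by_cases above : ∀ δ ∈ S, γ ≤ δ → ∃ d ∈ Δ, γ ≤ d ∧ d ≤ δ
  · exact hasEndpoint_of_finset_above hΔ above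
  · push Not at above
    obtain ⟨δ₂, hδ₂, hγδ₂, lt_of_ge⟩ := above
    refine hasEndpoint_of_finset_below hΔ fun δ₁ hδ₁ hδ₁γ => ?_
    obtain ⟨d, hd, hδ₁d, hdδ₂⟩ := h δ₁ hδ₁ δ₂ hδ₂ hδ₁γ hγδ₂
    exact ⟨d, hd, hδ₁d, not_le.1 fun hγd => (lt_of_ge d hd hγd).not_ge hdδ₂⟩

theorem HasEndpoint.definable {𝓛 : FirstOrder.Language} {M α : Type*} [𝓛.Structure M] {C : Set M}
    (h : HasEndpoint S γ) {t : (α → M) → Γ} (ht : ∀ z, t z ∈ S)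
    (hle : ∀ c ∈ S, C.Definable 𝓛 {z | c ≤ t z}) (hlt : ∀ c ∈ S, C.Definable 𝓛 {z | c < t z}) :
    C.Definable 𝓛 {z | γ ≤ t z} := by
  rcases h with h | h | ⟨c, hc, h⟩ | ⟨c, hc, h⟩
  · simp only [h _ (ht _)]
    exact Set.definable_univ
  · simp only [(h _ (ht _)).not_ge]
    exact Set.definable_empty
  · simpa only [h _ (ht _)] using hle c hc
  · simpa only [h _ (ht _)] using hlt c hc

end Cuts

section CutsInGroups

theorem coe_linearCombination {Γ ι : Type*} [AddCommGroup Γ] {H : AddSubgroup Γ} (b : ι → H)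
    (q : ι →₀ ℤ) : ((Finsupp.linearCombination ℤ b q : H) : Γ) =
      Finsupp.linearCombination ℤ (fun l => (b l : Γ)) q :=
  Finsupp.apply_linearCombination ℤ H.subtype.toIntLinearMap b q

variable {Γ : Type*} [AddCommGroup Γ] [LinearOrder Γ]

theorem definable_le_linearCombination {ι : Type*} (c : Γ) (q : ι →₀ ℤ) :
    (Set.univ : Set Γ).Definable oag {z : ι → Γ | c ≤ Finsupp.linearCombination ℤ z q} := by
  obtain ⟨t, ht⟩ := exists_term_realize_eq_linearCombination (G := Γ) q
  have definable := definable_rel₂ (M := Γ) orderRel.le (Term.var (Sum.inl c)) t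
  simp only [ht] at definable
  exact definable

theorem definable_lt_linearCombination {ι : Type*} (c : Γ) (q : ι →₀ ℤ) :
    (Set.univ : Set Γ).Definable oag {z : ι → Γ | c < Finsupp.linearCombination ℤ z q} := by
  obtain ⟨t, ht⟩ := exists_term_realize_eq_linearCombination (G := Γ) q
  have definable := (definable_rel₂ (M := Γ) orderRel.le t (Term.var (Sum.inl c))).compl
  simp only [ht] at definable
  simp only [← not_le]
  exact definable

variable [IsOrderedAddMonoid Γ] {H : AddSubgroup Γ}

theorem mem_halfspaceFamily_option_empty_iff [DivisibleBy Γ ℤ] {p : Γ × (Option Empty →₀ ℤ)}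
    {δ₁ δ₂ : Γ} (h : δ₁ ≤ δ₂)
    (hp : criticalPoint Empty.elim p < δ₁ ∨ δ₂ < criticalPoint Empty.elim p) :
    (fun o : Option Empty => o.elim δ₁ Empty.elim) ∈ halfspaceFamily Γ (Option Empty) p ↔
      (fun o : Option Empty => o.elim δ₂ Empty.elim) ∈ halfspaceFamily Γ (Option Empty) p := by
  simp only [halfspaceFamily, Set.mem_ofPred_eq]
  rcases lt_trichotomy (p.2 none) 0 with h0 | h0 | h0
  · rw [← le_criticalPoint_iff h0, ← le_criticalPoint_iff h0]
    grind
  · simp only [affineFun_option, h0, zero_smul]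
  · rw [← criticalPoint_le_iff h0, ← criticalPoint_le_iff h0]
    grind

theorem hasEndpoint_of_definable [DivisibleBy H ℤ] [Nontrivial H] {γ : Γ}
    (hγ : (Set.univ : Set H).Definable oag {b : Fin 1 → H | γ ≤ b 0}) :
    HasEndpoint (H : Set Γ) γ := by
  classical
  have elim := eliminatesQuantifiers_halfspaceFamily (G := H)
  obtain ⟨s, hs⟩ := elim.finitelyDetermined_reindex (fun _ => (none : Option Empty))
    (elim.finitelyDetermined_of_definable hγ)
  refine hasEndpoint_of_finset (Δ := s.image fun p => ((criticalPoint Empty.elim p : H) : Γ)) ?_ ?_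
  · simp only [Finset.forall_mem_image]
    exact fun p _ => (criticalPoint Empty.elim p : H).2
  · intro δ₁ hδ₁ δ₂ hδ₂ hδ₁γ hγδ₂
    by_contra! not_between
    rw [Finset.forall_mem_image] at not_between
    refine hδ₁γ.not_ge (hs (fun o => o.elim ⟨δ₂, hδ₂⟩ Empty.elim)
      (fun o => o.elim ⟨δ₁, hδ₁⟩ Empty.elim) (fun p hp => ?_) hγδ₂)
    have le : (⟨δ₁, hδ₁⟩ : H) ≤ ⟨δ₂, hδ₂⟩ := (hδ₁γ.trans_le hγδ₂).le
    refine (mem_halfspaceFamily_option_empty_iff le ?_).symm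
    exact (lt_or_ge _ _).imp_right (@not_between p hp)

theorem definable_halfspace_trace (hH : ∀ γ, HasEndpoint (H : Set Γ) γ) {ι : Type*}
    (p : Γ × (ι →₀ ℤ)) : (Set.univ : Set H).Definable oag
      ((fun (b : ι → H) l => (b l : Γ)) ⁻¹' halfspaceFamily Γ ι p) := by
  have definable := (hH (-p.1)).definable
    (t := fun b : ι → H => ((Finsupp.linearCombination ℤ b p.2 : H) : Γ)) (fun b => Subtype.prop _)
    (fun c hc => definable_le_linearCombination (⟨c, hc⟩ : H) p.2)
    (fun c hc => definable_lt_linearCombination (⟨c, hc⟩ : H) p.2)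
  simp only [coe_linearCombination, neg_le_iff_add_nonneg'] at definable
  exact definable

theorem hasEndpoint_of_T [DivisibleBy H ℤ] [Nontrivial H] (hT : T oag 1 (oagInclusion H)) (γ : Γ) :
    HasEndpoint (H : Set Γ) γ := by
  refine hasEndpoint_of_definable ?_
  exact hT (fun _ => γ) 1 (Relations.formula₂ (L := oag) orderRel.le (Term.var (Sum.inr 0))
    (Term.var (Sum.inl 0)))

theorem T_of_hasEndpoint [DivisibleBy Γ ℤ] [Nontrivial Γ] (hH : ∀ γ, HasEndpoint (H : Set Γ) γ) :
    T oag 1 (oagInclusion H) := by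
  intro a m φ
  have definable : (Set.univ : Set Γ).Definable oag {z : Fin m → Γ | φ.Realize (Sum.elim z a)} := by
    rw [Set.definable_iff_exists_formula_sum]
    refine ⟨φ.relabel (Sum.elim Sum.inr fun l => Sum.inl ⟨a l, trivial⟩), ?_⟩
    ext z
    rw [Set.mem_ofPred_eq, Set.mem_ofPred_eq, Formula.realize_relabel]
    refine iff_of_eq (congrArg _ ?_)
    ext (l | l) <;> rfl
  convert ((eliminatesQuantifiers_halfspaceFamily.finitelyDetermined_of_definable
    definable).preimage fun (b : Fin m → H) l => (b l : Γ)).definable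
      (definable_halfspace_trace hH) using 1
  ext b
  simp only [tp, Set.mem_ofPred_eq, Formula.realize_relabel, Set.mem_preimage]
  refine iff_of_eq (congrArg _ ?_)
  ext (l | l) <;> rfl

end CutsInGroups

section ValueGroup

theorem hasEndpoint_insert_top_iff {Γ : Type*} [LinearOrder Γ] {S : Set Γ} {γ : Γ} :
    HasEndpoint (insert ⊤ ((↑) '' S)) (γ : WithTop Γ) ↔ HasEndpoint S γ := by
  simp [HasEndpoint, or_assoc]

variable {L : Type*} {Γ : Type*} [Field L] [AddCommGroup Γ] [LinearOrder Γ] [IsOrderedAddMonoid Γ]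
  {v : AddValuation L (WithTop Γ)}

theorem exists_map_eq_coe {x : L} (hx : x ≠ 0) : ∃ γ : Γ, v x = γ := by
  obtain ⟨γ, hγ⟩ := WithTop.ne_top_iff_exists.1 (mt v.top_iff.1 hx)
  exact ⟨γ, hγ.symm⟩

theorem exists_nsmul_eq_of_isAlgClosed [IsAlgClosed L] {n : ℕ} (hn : n ≠ 0) {x : L} {γ : Γ}
    (hx : v x = γ) : ∃ (y : L) (δ : Γ), v y = δ ∧ n • δ = γ := by
  obtain ⟨y, rfl⟩ := IsAlgClosed.exists_pow_nat_eq x (Nat.pos_of_ne_zero hn)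
  have hy : y ≠ 0 := by
    rintro rfl
    simp [hn] at hx
  obtain ⟨δ, hδ⟩ := exists_map_eq_coe (v := v) hy
  refine ⟨y, δ, hδ, ?_⟩
  rw [v.map_pow, hδ] at hx
  exact_mod_cast hx

/-- The divisibility of the value group of an algebraically closed field, as data: quotients are
the values of chosen roots. -/
@[reducible]
noncomputable def divisibleByOfSurjective [IsAlgClosed L] (hv : Function.Surjective v) :
    DivisibleBy Γ ℤ :=
  have : DivisibleBy Γ ℕ := divisibleByOfSMulRightSurj Γ ℕ fun hn γ =>
    have ⟨_, hx⟩ := hv γ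
    have ⟨_, δ, _, hδ⟩ := exists_nsmul_eq_of_isAlgClosed hn hx
    ⟨δ, hδ⟩
  AddGroup.divisibleByIntOfDivisibleByNat Γ

variable {K : Subfield L}

noncomputable instance divisibleBy_valueGroup [IsAlgClosed K] :
    DivisibleBy (valueGroup v K) ℤ :=
  have : DivisibleBy (valueGroup v K) ℕ := divisibleByOfSMulRightSurj _ ℕ
    fun hn ⟨_, x, hxK, hx⟩ =>
      have ⟨y, δ, hy, hδ⟩ := exists_nsmul_eq_of_isAlgClosed (v := v.comap K.subtype) hn
        (x := ⟨x, hxK⟩) hx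
      ⟨⟨δ, y, y.2, hy⟩, Subtype.ext hδ⟩
  AddGroup.divisibleByIntOfDivisibleByNat _

theorem IsModel.nontrivial_valueGroup (hK : IsModel (v.comap K.subtype)) :
    Nontrivial (valueGroup v K) := by
  obtain ⟨x, hx, hvx⟩ := hK.nontrivial
  obtain ⟨γ, hγ⟩ := exists_map_eq_coe (v := v.comap K.subtype) hx
  refine ⟨⟨γ, x, x.2, hγ⟩, 0, fun h => hvx ?_⟩
  rw [hγ, ← WithTop.coe_zero]
  exact congrArg _ (congrArg Subtype.val h)

theorem range_comap_subtype :
    Set.range (v.comap K.subtype) = insert ⊤ ((↑) '' (valueGroup v K : Set Γ)) := by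
  ext γ
  constructor
  · rintro ⟨x, rfl⟩
    by_cases hx : x = 0
    · exact .inl (by rw [hx, AddValuation.map_zero])
    · obtain ⟨δ, hδ⟩ := exists_map_eq_coe (v := v.comap K.subtype) hx
      exact .inr ⟨δ, ⟨x, x.2, hδ⟩, hδ.symm⟩
  · rintro (rfl | ⟨δ, ⟨x, hxK, hx⟩, rfl⟩)
    · exact ⟨0, AddValuation.map_zero _⟩
    · exact ⟨⟨x, hxK⟩, hx⟩

theorem hasEndpoint_range_iff {γ : Γ} :
    HasEndpoint (Set.range (v.comap K.subtype)) (γ : WithTop Γ) ↔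
      HasEndpoint (valueGroup v K : Set Γ) γ := by
  rw [range_comap_subtype, hasEndpoint_insert_top_iff]

end ValueGroup

section BallTraces

variable {L : Type*} {Γ : Type*} [Field L] [AddCommGroup Γ] [LinearOrder Γ] [IsOrderedAddMonoid Γ]
  {v : AddValuation L (WithTop Γ)}

theorem cmp_map_sub_eq {x₁ x₂ a c : L} (h : v x₁ < v x₂) (ha : v a < v x₁ ∨ v x₂ < v a)
    (hc : v c < v x₁ ∨ v x₂ < v c) : cmp (v c) (v (x₁ - a)) = cmp (v c) (v (x₂ - a)) := by
  rcases ha with ha | ha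
  · rw [v.map_sub_eq_of_lt_right ha, v.map_sub_eq_of_lt_right (ha.trans h)]
  · rw [v.map_sub_eq_of_lt_left (h.trans ha), v.map_sub_eq_of_lt_left ha]
    rcases hc with hc | hc
    · rw [hc.cmp_eq_lt, (hc.trans h).cmp_eq_lt]
    · rw [(h.trans hc).cmp_eq_gt, hc.cmp_eq_gt]

theorem mem_ballFamily_iff_of_cmp_eq {x₁ x₂ : L} {k : (L × L) ⊕ (L × L)}
    (h : cmp (v (k.elim id id).2) (v (x₁ - (k.elim id id).1)) =
      cmp (v (k.elim id id).2) (v (x₂ - (k.elim id id).1))) :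
    x₁ ∈ ballFamily (valuationRing v).valuation (RingHom.id L) k ↔
      x₂ ∈ ballFamily (valuationRing v).valuation (RingHom.id L) k := by
  rcases k with p | p <;> simp only [ballFamily, Set.mem_ofPred_eq, RingHom.id_apply,
    valuationRing_valuation_le_iff, valuationRing_valuation_lt_iff]
  · exact le_iff_le_of_cmp_eq_cmp h
  · exact lt_iff_lt_of_cmp_eq_cmp h

theorem IsModel.hasEndpoint_of_definable (hv : IsModel v) {γ : WithTop Γ}
    (h : letI := valuedFieldStructure v
      (Set.univ : Set L).Definable ldiv {z : Fin 1 → L | γ ≤ v (z 0)}) :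
    HasEndpoint (Set.range v) γ := by
  classical
  obtain ⟨s, hs⟩ := hv.finitelyDetermined_ballFamily h
  let scales (k : (L × L) ⊕ (L × L)) : Finset (WithTop Γ) :=
    {v (k.elim id id).1, v (k.elim id id).2}
  refine hasEndpoint_of_finset (Δ := s.biUnion scales) ?_ ?_
  · simp only [Finset.mem_biUnion, scales, Finset.mem_insert, Finset.mem_singleton]
    rintro _ ⟨k, -, rfl | rfl⟩ <;> exact Set.mem_range_self _
  · rintro _ ⟨x₁, rfl⟩ _ ⟨x₂, rfl⟩ hlt hle
    by_contra! not_between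
    have outside (k) (hk : k ∈ s) (d) (hd : d ∈ scales k) : d < v x₁ ∨ v x₂ < d :=
      (lt_or_ge _ _).imp_right (not_between d (Finset.mem_biUnion.2 ⟨k, hk, hd⟩))
    refine hlt.not_ge (hs (fun _ => x₂) (fun _ => x₁) (fun k hk => ?_) hle)
    exact (mem_ballFamily_iff_of_cmp_eq (cmp_map_sub_eq (hlt.trans_le hle)
      (outside k hk _ (Finset.mem_insert_self _ _))
      (outside k hk _ (Finset.mem_insert_of_mem (Finset.mem_singleton_self _))))).symm

theorem definable_le_map_sub_of_hasEndpoint {γ : WithTop Γ} (h : HasEndpoint (Set.range v) γ)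
    (a : L) :
    letI := valuedFieldStructure v
    (Set.univ : Set L).Definable ldiv {z : Fin 1 → L | γ ≤ v (z 0 - a)} := by
  let := valuedFieldStructure v
  refine h.definable (fun z => Set.mem_range_self _) ?_ ?_ <;> rintro _ ⟨e, rfl⟩
  · exact definable_le_map_sub v e a
  · exact definable_lt_map_sub v e a

theorem definable_lt_map_sub_of_hasEndpoint {γ : WithTop Γ} (h : HasEndpoint (Set.range v) γ)
    (a : L) :
    letI := valuedFieldStructure v
    (Set.univ : Set L).Definable ldiv {z : Fin 1 → L | γ < v (z 0 - a)} := by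
  let := valuedFieldStructure v
  by_cases hγ : γ ∈ Set.range v
  · obtain ⟨e, rfl⟩ := hγ
    exact definable_lt_map_sub v e a
  · have ne (z : Fin 1 → L) : γ ≠ v (z 0 - a) := fun h => hγ ⟨_, h.symm⟩
    simpa only [lt_iff_le_and_ne, ne, and_true, ne_eq, not_false_eq_true] using
      definable_le_map_sub_of_hasEndpoint h a

theorem le_map_sub_iff_of_le_map_sub {γ : WithTop Γ} {a b : L} (h : γ ≤ v (b - a)) (x : L) :
    γ ≤ v (x - a) ↔ γ ≤ v (x - b) := by
  constructor <;> intro hx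
  · simpa only [sub_sub_sub_cancel_right] using v.map_le_sub hx h
  · simpa only [sub_add_sub_cancel] using v.map_le_add hx h

theorem lt_map_sub_iff_of_lt_map_sub {γ : WithTop Γ} {a b : L} (h : γ < v (b - a)) (x : L) :
    γ < v (x - a) ↔ γ < v (x - b) := by
  constructor <;> intro hx
  · simpa only [sub_sub_sub_cancel_right] using (lt_min hx h).trans_le (v.map_sub (x - a) (b - a))
  · simpa only [sub_add_sub_cancel] using v.map_lt_add hx h

theorem definable_ball (hv : Function.Surjective v) {B : Set L} (hB : IsBall v B) :
    letI := valuedFieldStructure v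
    (Set.univ : Set L).Definable₁ ldiv B := by
  let := valuedFieldStructure v
  obtain ⟨a, γ, rfl | rfl⟩ := hB <;> obtain ⟨e, he⟩ := hv γ <;> rw [← he]
  · exact definable_le_map_sub v e a
  · exact definable_lt_map_sub v e a

variable {K : Subfield L}

theorem definable_ball_trace (hK : ∀ γ, HasEndpoint (valueGroup v K : Set Γ) γ) {B : Set L}
    (hB : IsBall v B) :
    letI := valuedFieldStructure (v.comap K.subtype)
    (Set.univ : Set K).Definable₁ ldiv {x : K | (x : L) ∈ B} := by
  let := valuedFieldStructure (v.comap K.subtype)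
  rcases {x : K | (x : L) ∈ B}.eq_empty_or_nonempty with empty | ⟨b, hb⟩
  · rw [empty]
    exact Set.definable_empty
  -- Every point of a ball is a center, so the ball may be centered in `K`.
  obtain ⟨a, γ, rfl | rfl⟩ := hB
  · simp only [Set.mem_ofPred_eq, le_map_sub_iff_of_le_map_sub hb]
    exact definable_le_map_sub_of_hasEndpoint (hasEndpoint_range_iff.2 (hK γ)) b
  · simp only [Set.mem_ofPred_eq, lt_map_sub_iff_of_lt_map_sub hb]
    exact definable_lt_map_sub_of_hasEndpoint (hasEndpoint_range_iff.2 (hK γ)) b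

theorem definable_point_trace (a : L) :
    letI := valuedFieldStructure (v.comap K.subtype)
    (Set.univ : Set K).Definable₁ ldiv {x : K | (x : L) = a} := by
  let := valuedFieldStructure (v.comap K.subtype)
  by_cases ha : a ∈ K
  · have definable := definable_le_map_sub (v.comap K.subtype) 0 ⟨a, ha⟩
    simp only [AddValuation.map_zero, top_le_iff, AddValuation.top_iff, sub_eq_zero,
      ← Subtype.coe_inj] at definable
    exact definable
  · have ne (x : K) : (x : L) ≠ a := fun h => ha (h ▸ x.2)
    simp only [ne]
    exact Set.definable_empty

theorem definable_ballFamily_trace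
    (hB : letI := valuedFieldStructure (v.comap K.subtype)
      ∀ B : Set L, IsBall v B → (Set.univ : Set K).Definable₁ ldiv {x : K | (x : L) ∈ B})
    (k : (L × L) ⊕ (L × L)) :
    letI := valuedFieldStructure (v.comap K.subtype)
    (Set.univ : Set K).Definable₁ ldiv
      {x : K | (x : L) ∈ ballFamily (valuationRing v).valuation (RingHom.id L) k} := by
  let := valuedFieldStructure (v.comap K.subtype)
  rcases k with ⟨a, c⟩ | ⟨a, c⟩ <;> by_cases hc : c = 0 <;>
    simp only [ballFamily, Set.mem_ofPred_eq, RingHom.id_apply, valuationRing_valuation_le_iff,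
      valuationRing_valuation_lt_iff]
  · simp only [hc, AddValuation.map_zero, top_le_iff, AddValuation.top_iff, sub_eq_zero]
    exact definable_point_trace a
  · obtain ⟨γ, hγ⟩ := exists_map_eq_coe (v := v) hc
    simp only [hγ]
    exact hB _ ⟨a, γ, .inl rfl⟩
  · simp only [hc, AddValuation.map_zero, not_top_lt]
    exact Set.definable_empty
  · obtain ⟨γ, hγ⟩ := exists_map_eq_coe (v := v) hc
    simp only [hγ]
    exact hB _ ⟨a, γ, .inr rfl⟩

theorem IsModel.definable_trace (hL : IsModel v)
    (hB : letI := valuedFieldStructure (v.comap K.subtype)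
      ∀ B : Set L, IsBall v B → (Set.univ : Set K).Definable₁ ldiv {x : K | (x : L) ∈ B})
    {S : Set (Fin 1 → L)}
    (hS : letI := valuedFieldStructure v; (Set.univ : Set L).Definable ldiv S) :
    letI := valuedFieldStructure (v.comap K.subtype)
    (Set.univ : Set K).Definable ldiv {x : Fin 1 → K | (fun l => (x l : L)) ∈ S} := by
  let := valuedFieldStructure (v.comap K.subtype)
  exact ((hL.finitelyDetermined_ballFamily hS).preimage
    fun (x : Fin 1 → K) l => (x l : L)).definable (definable_ballFamily_trace hB)

end BallTraces

end ACVF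

theorem proposition2p3 {L : Type*} {Γ : Type*} [Field L]
    [AddCommGroup Γ] [LinearOrder Γ] [IsOrderedAddMonoid Γ]
    (v : AddValuation L (WithTop Γ)) (hv : Function.Surjective v) (K : Subfield L)
    (hL : ACVF.IsModel v) (hK : ACVF.IsModel (v.comap K.subtype)) :
    letI : ACVF.ldiv.Structure L := ACVF.valuedFieldStructure v
    letI : ACVF.ldiv.Structure K := ACVF.valuedFieldStructure (v.comap K.subtype)
    ∀ j : K ↪ₑ[ACVF.ldiv] L, (∀ x : K, j x = (x : L)) →
      List.TFAE [
        ACVF.W ACVF.ldiv 1 j.toEmbedding,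
        ∀ B : Set L, ACVF.IsBall v B →
          (Set.univ : Set K).Definable₁ ACVF.ldiv {x : K | (x : L) ∈ B},
        ACVF.T ACVF.oag 1 (ACVF.oagInclusion (ACVF.valueGroup v K))] := by
  let : ACVF.ldiv.Structure L := ACVF.valuedFieldStructure v
  let : ACVF.ldiv.Structure K := ACVF.valuedFieldStructure (v.comap K.subtype)
  intro j hj
  have := hL.isAlgClosed
  have := hK.isAlgClosed
  have := hK.nontrivial_valueGroup
  have : Nontrivial Γ := (Subtype.val_injective (p := (· ∈ ACVF.valueGroup v K))).nontrivial
  let := ACVF.divisibleByOfSurjective hv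
  have hcomp (x : Fin 1 → K) : j.toEmbedding ∘ x = fun l => (x l : L) := funext fun l => hj (x l)
  tfae_have 1 → 2 := by
    intro hW B hB
    have trace := hW _ (ACVF.definable_ball hv hB)
    simp only [hcomp] at trace
    exact trace
  tfae_have 2 → 1 := by
    intro hB S hS
    simp only [hcomp]
    exact hL.definable_trace hB hS
  tfae_have 2 → 3 := by
    refine fun hB => ACVF.T_of_hasEndpoint fun γ => ACVF.hasEndpoint_range_iff.1 ?_
    have trace := hB _ ⟨0, γ, .inl rfl⟩
    simp only [sub_zero] at trace
    exact hK.hasEndpoint_of_definable trace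
  tfae_have 3 → 2 := fun hT B hB => ACVF.definable_ball_trace (ACVF.hasEndpoint_of_T hT) hB
  tfae_finish
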